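/- Let $d,n\in\mathbb N_0$, $L>0$, $\theta>0$ and $V:\mathbb R^d\to(-\infty,\infty]$, with $e^{-\infty}=0$. A spatial partition of $n$ is a family $\lambda=(\lambda_x)_{x\in\mathbb Z^d}$ of integer partitions (possibly empty) whose components add up to $n$; $\Lambda_n$ denotes the countable set of these. Let $r_{xj}(\lambda)$ be the number of components of $\lambda_x$ equal to $j$, and $\eta_x(\lambda)=\sum_{j\ge1}j\,r_{xj}(\lambda)$. We think of $\lambda_x$ as the table sizes, and of $\eta_x$ as the number of customers, in a restaurant at $x$. Put $$w(\lambda)=\prod_{x\in\mathbb Z^d}\prod_{j\ge1}\frac1{r_{xj}(\lambda)!}\Bigl(\frac{\theta}{j}\,e^{-jV(x/L)}\Bigr)^{r_{xj}(\lambda)},\qquad Z_{L,n}=\sum_{\lambda\in\Lambda_n}w(\lambda),$$ assume $0<Z_{L,n}<\infty$, and let $\mathbb P_{L,n}(\lambda)=w(\lambda)/Z_{L,n}$. Let $$h_m=\sum_{\lambda\vdash m}\prod_{j\ge1}\frac1{r_j(\lambda)!}\Bigl(\frac\theta j\Bigr)^{r_j(\lambda)},\qquad g(m)=\frac{h_{m-1}}{h_m}\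 (m\ge1),\qquad g(0)=0,$$ where the sum is over the integer partitions of $m$ and $r_j(\lambda)$ is the number of components of $\lambda$ equal to $j$. Let $t(x,y)\ge0$ ($x,y\in\mathbb Z^d$) satisfy $\sum_y t(x,y)=1$ and $e^{-V(x/L)}t(x,y)=e^{-V(y/L)}t(y,x)$ for all $x,y$. Consider the following "chain of Chinese restaurants" dynamics on $\Lambda_n$: a customer at a table of size $j\ge1$ in restaurant $x$ leaves it, moves to restaurant $y$ ($y=x$ being allowed), and there joins a table of size $k$ (if $k\ge1$) or opens a new table (if $k=0$), at rate $$g(\eta_x)\;t(x,y)\;\frac{j\,r_{xj}}{\eta_x}\;p_+(k;\lambda_y^*),\qquad p_+(k;\lambda_y^*)=\frac{k\,r^*_{yk}}{\eta^*_y+\theta}\ (k\ge1),\quad p_+(0;\lambda_y^*)=\frac{\theta}{\eta^*_y+\theta}.$$ The star means that the quantity is evaluated after the customer has left $x$ (this matters only if $y=x$), and the rate is $0$ if $\eta_x=0$. For $\lambda\ne\lambda'$ let $q(\lambda,\lambda')$ be the rate at which such moves lead from $\lambda$ to $\lambda'$, let $q(\lambda,\lambda)=-\sum_{\lambda'\neq\lambda}q(\lambda,\lambda')$,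 and $Q=(q(\lambda,\lambda'))$. Then there is a unique Markov semigroup $(P_t(\lambda,\lambda'))_{t\ge0}$ on $\Lambda_n$ (that is, stochastic matrices with $P_0(\lambda,\lambda')=\delta_{\lambda,\lambda'}$ and $P_sP_t=P_{s+t}$) that solves the backward Kolmogorov equations $$\frac{\partial P_t}{\partial t}(\lambda,\lambda')=\sum_{\lambda''\in\Lambda_n}q(\lambda,\lambda'')\,P_t(\lambda'',\lambda'),\qquad t\ge0,\ \lambda,\lambda'\in\Lambda_n .$$ It defines a Markov process with state space $\Lambda_n$: for every initial law on $\Lambda_n$ there is a Markov process $(\lambda(t))_{t\ge0}$ with this initial law and with transition function $(P_t)$. The measure $\mathbb P_{L,n}$ is reversible for it, $$\mathbb P_{L,n}(\lambda)P_t(\lambda,\lambda')=\mathbb P_{L,n}(\lambda')P_t(\lambda',\lambda)\qquad\text{for all }t\ge0,\ \lambda,\lambda'\in\Lambda_n,$$ and hence stationary, $\sum_{\lambda}\mathbb P_{L,n}(\lambda)P_t(\lambda,\lambda')=\mathbb P_{L,n}(\lambda')$ for all $t\geq 0$ and $\lambda'\in\Lambda_n$. -/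

import Mathlib

open scoped NNReal ENNReal

noncomputable section

/-- The lattice `ℤ^d` of sites (restaurants). -/
abbrev Site (d : ℕ) : Type := Fin d → ℤ

/-- `Λ_n`: spatial partitions of `n`. To each site `x` a partition is attached, recorded as the
multiset `parts x` of its (positive) components; the components of all sites add up to `n`.
As components are at least `1`, only finitely many sites carry a non-empty partition. -/
@[ext]
structure SpatialPartition (d n : ℕ) where
  parts : Site d →₀ Multiset ℕ
  parts_pos : ∀ x, ∀ j ∈ parts x, 0 < j
  sum_eq : (parts.sum fun _ m => m.sum) = n

/-- `Λ_n` is countable; it carries the discrete σ-algebra. -/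
instance (d n : ℕ) : MeasurableSpace (SpatialPartition d n) := ⊤

/-- `∏_{j ≥ 1} a_j ^ {r_j} / r_j!`, where `r_j` is the number of times that `j` occurs in `m`
(the factors with `r_j = 0` are equal to `1`). -/
def occupationWeight (a : ℕ → ℝ) (m : Multiset ℕ) : ℝ :=
  ∏ j ∈ m.toFinset, a j ^ m.count j / ((m.count j).factorial : ℝ)

/-- `e^{-v}` for `v ∈ (-∞, ∞]`, with `e^{-∞} = 0`. -/
def expNeg : WithTop ℝ → ℝ
  | ⊤ => 0
  | (r : ℝ) => Real.exp (-r)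

/-- `V(x/L)`. -/
def scaledPotential {d : ℕ} (V : (Fin d → ℝ) → WithTop ℝ) (L : ℝ) (x : Site d) : WithTop ℝ :=
  V fun i => (x i : ℝ) / L

/-- The unnormalized Gibbs weight
`∏_x ∏_{j ≥ 1} (1 / r_{xj}!) ((θ_j / j) e^{-j V(x/L)}) ^ {r_{xj}}` of a spatial partition. -/
def gibbsWeight {d n : ℕ} (θ : ℕ → ℝ) (V : (Fin d → ℝ) → WithTop ℝ) (L : ℝ)
    (a : SpatialPartition d n) : ℝ :=
  ∏ x ∈ a.parts.support,
    occupationWeight (fun j => θ j / j * expNeg (scaledPotential V L x) ^ j) (a.parts x)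

/-- The normalization `Z_{L,n}`, an element of `[0, ∞]`. -/
def partitionFunction {d : ℕ} (n : ℕ) (θ : ℕ → ℝ) (V : (Fin d → ℝ) → WithTop ℝ) (L : ℝ) : ℝ≥0∞ :=
  ∑' a : SpatialPartition d n, ENNReal.ofReal (gibbsWeight θ V L a)

/-- The probability distribution `ℙ_{L,n}` on `Λ_n`: the Gibbs weight divided by `Z_{L,n}`. -/
def gibbsMeasure {d : ℕ} (n : ℕ) (θ : ℕ → ℝ) (V : (Fin d → ℝ) → WithTop ℝ) (L : ℝ)
    (h0 : partitionFunction n θ V L ≠ 0) (htop : partitionFunction n θ V L ≠ ∞) :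
    PMF (SpatialPartition d n) :=
  PMF.normalize (fun a => ENNReal.ofReal (gibbsWeight θ V L a)) h0 htop

/-- `h_m = ∑_{λ ⊢ m} ∏_{j ≥ 1} (1 / r_j(λ)!) (θ_j / j) ^ {r_j(λ)}`. -/
def hCoeff (θ : ℕ → ℝ) (m : ℕ) : ℝ :=
  ∑ p : Nat.Partition m, occupationWeight (fun j => θ j / j) p.parts

/-- Rate `g(m) = h_{m-1} / h_m`, `g(0) = 0`, at which a customer leaves a restaurant with `m`
customers. -/
def exitRate (θ : ℕ → ℝ) : ℕ → ℝ
  | 0 => 0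
  | m + 1 => hCoeff θ m / hCoeff θ (m + 1)

/-- Probability that a uniformly chosen customer of a restaurant with table occupation `m`
sits at a table of size `j`. -/
def leaveProb (j : ℕ) (m : Multiset ℕ) : ℝ := (j * m.count j : ℝ) / m.sum

/-- Probability that a customer entering a restaurant with table occupation `m` joins a table of
size `k` (if `k ≥ 1`) or opens a new table (if `k = 0`). -/
def joinProb (θ : ℝ) (k : ℕ) (m : Multiset ℕ) : ℝ :=
  if k = 0 then θ / (m.sum + θ) else (k * m.count k : ℝ) / (m.sum + θ)

/-- Table occupation after a customer at a `j`-table has left (a `1`-table disappears). -/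
def removeCustomer (j : ℕ) (m : Multiset ℕ) : Multiset ℕ :=
  m.erase j + if j ≤ 1 then 0 else {j - 1}

/-- Table occupation after a customer has joined a `k`-table; a new table if `k = 0` (the
occupation has no part `0`, so that nothing is erased then). -/
def addCustomer (k : ℕ) (m : Multiset ℕ) : Multiset ℕ := m.erase k + {k + 1}

/-- The configuration after a customer has left a `j`-table at `x`. -/
def afterLeaving {d : ℕ} (c : Site d →₀ Multiset ℕ) (x : Site d) (j : ℕ) :
    Site d →₀ Multiset ℕ :=
  c.update x (removeCustomer j (c x))

/-- The configuration after a customer has left a `j`-table at `x` and then joined a `k`-table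
at `y` (`y = x` is allowed). -/
def afterMove {d : ℕ} (c : Site d →₀ Multiset ℕ) (x y : Site d) (j k : ℕ) :
    Site d →₀ Multiset ℕ :=
  (afterLeaving c x j).update y (addCustomer k (afterLeaving c x j y))

/-- Rate `g(η_x) t(x,y) p₋(j; λ_x) p₊(k; λ_y)` of the move of a customer from a `j`-table at `x`
to a `k`-table at `y`. The customer chooses the new table when the old one has been left, so that
`λ_y` is `λ_x` without this customer if `y = x`. The rate vanishes if there is no `j`-table at `x`,
or if `k ≥ 1` and there is no `k`-table at `y`. -/
def moveRate {d : ℕ} (θ : ℝ) (t : Site d → Site d → ℝ) (c : Site d →₀ Multiset ℕ)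
    (x y : Site d) (j k : ℕ) : ℝ :=
  exitRate (fun _ => θ) (c x).sum * t x y * leaveProb j (c x) *
    joinProb θ k (afterLeaving c x j y)

open Classical in
/-- The rate `q(a, b)` for `a ≠ b`: the total rate of all moves that lead from `a` to `b`
(there is at most one such move with a non-zero rate). -/
def jumpRate {d n : ℕ} (θ : ℝ) (t : Site d → Site d → ℝ) (a b : SpatialPartition d n) : ℝ :=
  ∑' m : (Site d × Site d) × ℕ × ℕ,
    if afterMove a.parts m.1.1 m.1.2 m.2.1 m.2.2 = b.parts then
      moveRate θ t a.parts m.1.1 m.1.2 m.2.1 m.2.2 else 0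

open Classical in
/-- The `Q`-matrix: jump rates off the diagonal, and `q(a, a) = -∑_{b ≠ a} q(a, b)`. -/
def restaurantQ {d n : ℕ} (θ : ℝ) (t : Site d → Site d → ℝ) (a b : SpatialPartition d n) : ℝ :=
  if a = b then -∑' c, (if c = a then 0 else jumpRate θ t a c) else jumpRate θ t a b

section Markov

variable {S : Type*}

open Classical in
/-- A Markov semigroup (standard initial condition, stochastic matrices, Chapman–Kolmogorov). -/
structure IsMarkovSemigroup (P : ℝ≥0 → S → S → ℝ) : Prop where
  nonneg : ∀ t a b, 0 ≤ P t a b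
  hasSum_one : ∀ t a, HasSum (fun b => P t a b) 1
  zero : ∀ a b, P 0 a b = if a = b then 1 else 0
  add : ∀ s t a b, HasSum (fun c => P s a c * P t c b) (P (s + t) a b)

/-- The backward Kolmogorov equations `∂P_t/∂t = Q P_t` for all `t ≥ 0`
(one-sided derivative at `t = 0`), with absolutely convergent sums. -/
def SolvesBackward (Q : S → S → ℝ) (P : ℝ≥0 → S → S → ℝ) : Prop :=
  ∀ (t : ℝ≥0) (a b : S),
    Summable (fun c => Q a c * P t c b) ∧
    HasDerivWithinAt (fun s : ℝ => P s.toNNReal a b) (∑' c, Q a c * P t c b) (Set.Ici 0) (t : ℝ)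

/-- `X` is a Markov process, on the probability space `(Ω, ℙ)`, with initial law `μ` and
transition function `P`: for all times `0 = τ_0 ≤ τ_1 ≤ … ≤ τ_k` and states `a_0, …, a_k`,
`ℙ(X_{τ_0} = a_0, …, X_{τ_k} = a_k) = μ(a_0) ∏_{i < k} P_{τ_{i+1} - τ_i}(a_i, a_{i+1})`. -/
structure IsMarkovProcess [MeasurableSpace S] (P : ℝ≥0 → S → S → ℝ) (μ : PMF S)
    {Ω : Type*} [MeasurableSpace Ω] (ℙ : MeasureTheory.Measure Ω) (X : ℝ≥0 → Ω → S) : Prop where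
  isProbabilityMeasure : MeasureTheory.IsProbabilityMeasure ℙ
  measurable : ∀ t, Measurable (X t)
  finiteDim : ∀ (k : ℕ) (τ : Fin (k + 1) → ℝ≥0), τ 0 = 0 → Monotone τ →
    ∀ a : Fin (k + 1) → S,
      ℙ {ω | ∀ i, X (τ i) ω = a i} =
        μ (a 0) * ENNReal.ofReal
          (∏ i : Fin k, P (τ i.succ - τ i.castSucc) (a i.castSucc) (a i.succ))

/-- `μ` is reversible for the Markov process with transition function `P`. -/
def IsReversibleLaw (μ : PMF S) (P : ℝ≥0 → S → S → ℝ) : Prop :=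
  ∀ t a b, (μ a).toReal * P t a b = (μ b).toReal * P t b a

/-- `μ` is stationary for the Markov process with transition function `P`. -/
def IsStationaryLaw (μ : PMF S) (P : ℝ≥0 → S → S → ℝ) : Prop :=
  ∀ t b, HasSum (fun a => (μ a).toReal * P t a b) (μ b).toReal

end Markov

end

/-! The generator is bounded, so the semigroup is an operator exponential. The recursion `(m + 1)
h_{m+1} = (m + θ) h_m` (`hCoeff_succ`) gives `g(m + 1) = (m + 1) / (m + θ)`. Hence `g(η_x) ≤ η_x /
θ`, and as the `η_x` add up to `n`, every configuration is left at rate at most `n / θ`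
(`isBoundedQMatrix_restaurantQ`).

For a conservative `Q` with bounded exit rates, the rows define a bounded operator on `ℓ¹`, and `P_t
= e^{tQ}`. Positivity comes from shifting `Q` by a multiple of the identity, mass conservation from
the vanishing row sums, and uniqueness from iterating the integrated backward equation. Detailed
balance for `Q` passes to its powers and so to `e^{tQ}`. The process itself is built by Kolmogorov
extension, whose compactness argument on a countable state space needs only finite sets of large
mass.

Detailed balance for `Q` rests on the explicit `g`: the factor `g(η_x) j r_{xj} / η_x` equals `j
r_{xj} / (η*_x + θ)`, with the denominator of the seating probabilities. Therefore weight times rate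
of a move depends only on the configuration `λ*` in which the travelling customer is absent: it is
`e^{-V(x/L)} t(x,y) w(λ*)` times the probabilities of taking the old seat and of taking the new one
(`configWeight_mul_moveRate`). The reverse move passes through the same `λ*` with the two seats
exchanged, and the balance condition on `t` does the rest. Summing over moves gives
`configWeight_mul_jumpRate`. -/

noncomputable section

/-! ### Bounded operators on `ℓ¹` as matrices acting on row vectors. -/

section SummableSequences

variable {S : Type*}

/-- The Banach space `ℓ¹(S)`. -/
abbrev ellOne (S : Type*) : Type _ := lp (fun _ : S => ℝ) 1

theorem HasSum.congr_sum {ι : Type*} {f : ι → ℝ} {x y : ℝ} (h : HasSum f x) (e : x = y) :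
    HasSum f y := e ▸ h

theorem HasSum.of_eq {ι : Type*} {f g : ι → ℝ} {x : ℝ} (h : HasSum f x) (e : ∀ i, f i = g i) :
    HasSum g x := funext e ▸ h

theorem ellOne.summable_norm (f : ellOne S) : Summable fun a => ‖f a‖ := by
  simpa using (lp.memℓp f).summable (by simp)

theorem ellOne.norm_eq_tsum (f : ellOne S) : ‖f‖ = ∑' a, ‖f a‖ := by
  simpa using lp.norm_eq_tsum_rpow (p := 1) (by simp) f

/-- A summable function as an element of `ℓ¹`. -/
def ellOne.mk (r : S → ℝ) (hr : Summable fun a => ‖r a‖) : ellOne S :=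
  ⟨r, memℓp_gen (by simpa using hr)⟩

open Classical in
/-- The unit vectors of `ℓ¹`. -/
def ellOne.unit (a : S) : ellOne S := lp.single 1 a 1

open Classical in
theorem ellOne.unit_apply (a b : S) : ellOne.unit a b = if a = b then (1 : ℝ) else 0 := by
  unfold ellOne.unit
  by_cases h : a = b
  · subst h; simp
  · simp [lp.single_apply, h, Ne.symm h]

theorem ellOne.hasSum_unit (f : ellOne S) : HasSum (fun a => f a • ellOne.unit a) f := by
  classical
  have := lp.hasSum_single (p := 1) (by simp) f
  convert this using 2 with a
  rw [ellOne.unit, ← lp.single_smul]; simp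

/-- Coordinate functionals. -/
abbrev ellOne.eval (a : S) : ellOne S →L[ℝ] ℝ := lp.evalCLM ℝ (fun _ : S => ℝ) 1 a

theorem ellOne.hasSum_map {F : Type*} [NormedAddCommGroup F] [NormedSpace ℝ F]
    (T : ellOne S →L[ℝ] F) (f : ellOne S) : HasSum (fun a => f a • T (ellOne.unit a)) (T f) := by
  simpa using T.hasSum (ellOne.hasSum_unit f)

/-- Row vector times matrix: `T (unit a) b` is the `(a, b)` entry of `T`. Composition of operators
thus becomes the matrix product in reversed order. -/
theorem ellOne.hasSum_map_apply (T : ellOne S →L[ℝ] ellOne S) (f : ellOne S) (b : S) :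
    HasSum (fun a => f a * T (ellOne.unit a) b) (T f b) := by
  exact ellOne.hasSum_map ((ellOne.eval b).comp T) f

theorem ellOne.summable_smul {F : Type*} [NormedAddCommGroup F] [NormedSpace ℝ F] [CompleteSpace F]
    {r : S → F} {M : ℝ} (hr : ∀ a, ‖r a‖ ≤ M) (f : ellOne S) :
    Summable fun a => ‖f a • r a‖ := by
  refine Summable.of_nonneg_of_le (fun _ => norm_nonneg _) (fun a => ?_)
    ((ellOne.summable_norm f).mul_right M)
  rw [norm_smul]
  exact mul_le_mul_of_nonneg_left (hr a) (norm_nonneg _)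

/-- The bounded operator on `ℓ¹` with prescribed values at the unit vectors. -/
def ellOne.lift {F : Type*} [NormedAddCommGroup F] [NormedSpace ℝ F] [CompleteSpace F]
    (r : S → F) (M : ℝ) (hr : ∀ a, ‖r a‖ ≤ M) : ellOne S →L[ℝ] F :=
  LinearMap.mkContinuous
    { toFun := fun f => ∑' a, f a • r a
      map_add' := fun f g => by
        rw [← ((ellOne.summable_smul hr f).of_norm).tsum_add ((ellOne.summable_smul hr g).of_norm)]
        exact tsum_congr fun a => by simp [add_smul]
      map_smul' := fun c f => by
        simp only [RingHom.id_apply]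
        rw [← ((ellOne.summable_smul hr f).of_norm).tsum_const_smul]
        exact tsum_congr fun a => by simp [mul_smul] }
    M (fun f => by
      refine (norm_tsum_le_tsum_norm (ellOne.summable_smul hr f)).trans ?_
      rw [ellOne.norm_eq_tsum, ← tsum_mul_left]
      refine (ellOne.summable_smul hr f).tsum_le_tsum (fun a => ?_)
        ((ellOne.summable_norm f).mul_left M)
      rw [norm_smul, mul_comm]
      exact mul_le_mul_of_nonneg_right (hr a) (norm_nonneg _))

theorem ellOne.lift_unit {F : Type*} [NormedAddCommGroup F] [NormedSpace ℝ F] [CompleteSpace F]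
    (r : S → F) (M : ℝ) (hr : ∀ a, ‖r a‖ ≤ M) (a : S) :
    ellOne.lift r M hr (ellOne.unit a) = r a := by
  classical
  change ∑' b, ellOne.unit a b • r b = r a
  rw [tsum_eq_single a]
  · simp [ellOne.unit_apply]
  · intro b hb
    simp [ellOne.unit_apply, hb.symm]

/-- Summation, as a functional on `ℓ¹`. -/
def ellOne.total (S : Type*) : ellOne S →L[ℝ] ℝ :=
  ellOne.lift (fun _ => 1) 1 (by simp)

theorem ellOne.hasSum_total (f : ellOne S) : HasSum (fun a => f a) (ellOne.total S f) := by
  have := ellOne.hasSum_map (ellOne.total S) f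
  simpa [ellOne.total, ellOne.lift_unit] using this

/-- Reduces properties of entries and row sums of `e^{tQ}` to properties of the powers of `Q`. -/
theorem hasSum_exp_apply {E F : Type*} [NormedAddCommGroup E] [NormedSpace ℝ E] [CompleteSpace E]
    [NormedAddCommGroup F] [NormedSpace ℝ F] (A : E →L[ℝ] E) (φ : E →L[ℝ] F) (f : E) :
    HasSum (fun k : ℕ => ((k.factorial : ℝ)⁻¹) • φ ((A ^ k) f)) (φ (NormedSpace.exp A f)) := by
  have h := NormedSpace.exp_series_hasSum_exp' (𝕂 := ℝ) A
  have h2 := (φ.comp (ContinuousLinearMap.apply ℝ E f)).hasSum h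
  simpa using h2

end SummableSequences

/-! ### The semigroup of a bounded conservative `Q`-matrix. -/

section BoundedGenerator

variable {S : Type*}

/-- A conservative `Q`-matrix with bounded exit rates. -/
structure IsBoundedQMatrix (Q : S → S → ℝ) (C : ℝ) : Prop where
  nonneg : ∀ a b, a ≠ b → 0 ≤ Q a b
  hasSum_zero : ∀ a, HasSum (fun b => Q a b) 0
  neg_diag_le : ∀ a, -Q a a ≤ C

namespace IsBoundedQMatrix

variable {Q : S → S → ℝ} {C : ℝ}

/-- Only the diagonal entry can be negative and the row adds up to `0`, so the off-diagonal mass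
equals `-Q a a` and is counted twice. -/
theorem hasSum_norm (hQ : IsBoundedQMatrix Q C) (a : S) :
    HasSum (fun b => ‖Q a b‖) (-2 * Q a a) := by
  classical
  have h1 := hQ.hasSum_zero a
  have hneg : Q a a ≤ 0 := by
    have h2 : HasSum (fun b => if b = a then 0 else Q a b) (0 - Q a a) := by
      have := h1.sub (hasSum_ite_eq a (Q a a))
      refine this.of_eq fun b => ?_
      by_cases h : b = a
      · subst h; simp
      · simp [h]
    have := h2.nonneg (fun b => by
      by_cases h : b = a
      · simp [h]
      · simpa [h] using hQ.nonneg a b (Ne.symm h))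
    linarith
  have := h1.sub (hasSum_ite_eq a (2 * Q a a))
  rw [show -2 * Q a a = 0 - 2 * Q a a by ring]
  refine this.of_eq fun b => ?_
  by_cases h : b = a
  · subst h
    simp only [if_true, Real.norm_eq_abs, abs_of_nonpos hneg]; ring
  · simp [h, abs_of_nonneg (hQ.nonneg a b (Ne.symm h))]

/-- The rows of `Q`, as elements of `ℓ¹`. -/
def row (hQ : IsBoundedQMatrix Q C) (a : S) : ellOne S :=
  ellOne.mk (Q a) (hQ.hasSum_norm a).summable

theorem row_apply (hQ : IsBoundedQMatrix Q C) (a b : S) : hQ.row a b = Q a b := rfl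

theorem norm_row_le (hQ : IsBoundedQMatrix Q C) (a : S) : ‖hQ.row a‖ ≤ 2 * C := by
  rw [ellOne.norm_eq_tsum]
  have : ∑' b, ‖hQ.row a b‖ = -2 * Q a a := (hQ.hasSum_norm a).tsum_eq
  rw [this]
  linarith [hQ.neg_diag_le a]

/-- The generator, acting on row vectors. -/
def generator (hQ : IsBoundedQMatrix Q C) : ellOne S →L[ℝ] ellOne S :=
  ellOne.lift hQ.row (2 * C) hQ.norm_row_le

theorem generator_unit (hQ : IsBoundedQMatrix Q C) (a : S) :
    hQ.generator (ellOne.unit a) = hQ.row a := ellOne.lift_unit _ _ _ a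

/-- The transition function `e^{tQ}`. -/
def transition (hQ : IsBoundedQMatrix Q C) (t : ℝ≥0) (a b : S) : ℝ :=
  NormedSpace.exp ((t : ℝ) • hQ.generator) (ellOne.unit a) b

/-- Uniformization: since `C` bounds the exit rates, adding it on the diagonal makes all entries
nonnegative. -/
theorem generator_add_nonneg (hQ : IsBoundedQMatrix Q C) (f : ellOne S) (hf : ∀ a, 0 ≤ f a)
    (b : S) : 0 ≤ (hQ.generator + C • (1 : ellOne S →L[ℝ] ellOne S)) f b := by
  classical
  refine (ellOne.hasSum_map_apply _ f b).nonneg fun a => mul_nonneg (hf a) ?_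
  have : (hQ.generator + C • (1 : ellOne S →L[ℝ] ellOne S)) (ellOne.unit a) b
      = Q a b + C * ellOne.unit a b := by
    change (hQ.generator (ellOne.unit a) + C • ellOne.unit a : ellOne S) b = _
    rw [generator_unit]
    rfl
  rw [this, ellOne.unit_apply]
  by_cases h : a = b
  · subst h; simp; linarith [hQ.neg_diag_le a]
  · simpa [h] using hQ.nonneg a b h

theorem transition_nonneg (hQ : IsBoundedQMatrix Q C) (t : ℝ≥0) (a b : S) :
    0 ≤ hQ.transition t a b := by
  classical
  set B : ellOne S →L[ℝ] ellOne S := hQ.generator + C • (1 : ellOne S →L[ℝ] ellOne S) with hB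
  have hpow : ∀ k : ℕ, ∀ c, 0 ≤ (B ^ k) (ellOne.unit a) c := by
    intro k
    induction k with
    | zero => intro c; simp only [pow_zero, one_apply_eq_self, ellOne.unit_apply]
              split_ifs <;> norm_num
    | succ k ih =>
      intro c
      rw [pow_succ', mul_apply_eq_comp]
      exact hQ.generator_add_nonneg _ ih c
  have hexp : 0 ≤ NormedSpace.exp ((t : ℝ) • B) (ellOne.unit a) b := by
    refine (hasSum_exp_apply ((t : ℝ) • B) (ellOne.eval b) (ellOne.unit a)).nonneg fun k => ?_
    rw [smul_pow]
    have := hpow k b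
    simp only [smul_apply, map_smul, smul_eq_mul]
    have h2 : 0 ≤ (ellOne.eval b) ((B ^ k) (ellOne.unit a)) := this
    positivity
  -- The scalar `-tC` commutes with everything, so `e^{tQ}` is a positive number times `e^{t(Q +
  -- C)}`, whose series has nonnegative terms.
  have hdecomp : (t : ℝ) • hQ.generator
      = (t : ℝ) • B + algebraMap ℝ (ellOne S →L[ℝ] ellOne S) (-(t * C)) := by
    rw [hB, Algebra.algebraMap_eq_smul_one]
    module
  unfold transition
  let _ : NormedAlgebra ℚ (ellOne S →L[ℝ] ellOne S) := NormedAlgebra.restrictScalars ℚ ℝ _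
  rw [hdecomp, NormedSpace.exp_add_of_commute (Algebra.commutes _ _).symm,
    ← NormedSpace.algebraMap_exp_comm (𝕂 := ℝ), Algebra.algebraMap_eq_smul_one,
    mul_smul_comm, mul_one]
  have : 0 ≤ NormedSpace.exp (-(t * C) : ℝ) := by
    rw [← Real.exp_eq_exp_ℝ]; positivity
  exact mul_nonneg this hexp

theorem total_generator (hQ : IsBoundedQMatrix Q C) (f : ellOne S) :
    ellOne.total S (hQ.generator f) = 0 := by
  have h := ellOne.hasSum_map ((ellOne.total S).comp hQ.generator) f
  have h0 : ∀ a, ((ellOne.total S).comp hQ.generator) (ellOne.unit a) = 0 := fun a => by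
    simp only [ContinuousLinearMap.comp_apply, generator_unit]
    exact (ellOne.hasSum_total _).unique (hQ.hasSum_zero a)
  simp only [h0, smul_zero] at h
  exact h.unique _root_.hasSum_zero

theorem hasSum_transition (hQ : IsBoundedQMatrix Q C) (t : ℝ≥0) (a : S) :
    HasSum (fun b => hQ.transition t a b) 1 := by
  classical
  have h := ellOne.hasSum_total (NormedSpace.exp ((t : ℝ) • hQ.generator) (ellOne.unit a))
  rw [show (1 : ℝ) = ellOne.total S (NormedSpace.exp ((t : ℝ) • hQ.generator)
    (ellOne.unit a)) from ?_]
  · exact h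
  have h2 := hasSum_exp_apply ((t : ℝ) • hQ.generator) (ellOne.total S) (ellOne.unit a)
  refine HasSum.unique ?_ h2
  have h3 : ellOne.total S (ellOne.unit a) = 1 := ellOne.lift_unit _ _ _ a
  -- The image of the generator has total mass `0`, so only the term of order `0` in the series
  -- contributes.
  refine (hasSum_ite_eq 0 (1 : ℝ)).of_eq fun k => ?_
  cases k with
  | zero => simp [h3]
  | succ k => simp [pow_succ', total_generator]

theorem transition_zero (hQ : IsBoundedQMatrix Q C) (a b : S) [Decidable (a = b)] :
    hQ.transition 0 a b = if a = b then 1 else 0 := by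
  simp [transition, ellOne.unit_apply]

theorem hasSum_transition_add (hQ : IsBoundedQMatrix Q C) (s t : ℝ≥0) (a b : S) :
    HasSum (fun c => hQ.transition s a c * hQ.transition t c b) (hQ.transition (s + t) a b) := by
  have h := ellOne.hasSum_map_apply (NormedSpace.exp ((t : ℝ) • hQ.generator))
    (NormedSpace.exp ((s : ℝ) • hQ.generator) (ellOne.unit a)) b
  refine (show HasSum (fun c => hQ.transition s a c * hQ.transition t c b) _ from h).congr_sum ?_
  let _ : NormedAlgebra ℚ (ellOne S →L[ℝ] ellOne S) := NormedAlgebra.restrictScalars ℚ ℝ _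
  rw [show hQ.transition (s + t) a b = NormedSpace.exp (((s + t : ℝ≥0) : ℝ) • hQ.generator)
    (ellOne.unit a) b from rfl, NNReal.coe_add, add_comm, add_smul,
    NormedSpace.exp_add_of_commute]
  · rfl
  · exact ((Commute.refl _).smul_left _).smul_right _

theorem isMarkovSemigroup_transition (hQ : IsBoundedQMatrix Q C) :
    IsMarkovSemigroup hQ.transition where
  nonneg := hQ.transition_nonneg
  hasSum_one := hQ.hasSum_transition
  zero a b := by classical exact hQ.transition_zero a b
  add := hQ.hasSum_transition_add

/-- On row vectors the factor applied first is the left matrix factor: `exp * generator` in operator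
order is the matrix product `Q P_t`, which is what the backward equation needs. -/
theorem hasSum_mul_transition (hQ : IsBoundedQMatrix Q C) (t : ℝ≥0) (a b : S) :
    HasSum (fun c => Q a c * hQ.transition t c b)
      ((NormedSpace.exp ((t : ℝ) • hQ.generator) * hQ.generator) (ellOne.unit a) b) := by
  have h := ellOne.hasSum_map_apply (NormedSpace.exp ((t : ℝ) • hQ.generator)) (hQ.row a) b
  rw [mul_apply_eq_comp, generator_unit]
  exact h

theorem solvesBackward_transition (hQ : IsBoundedQMatrix Q C) :
    SolvesBackward Q hQ.transition := by
  intro t a b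
  have h := hQ.hasSum_mul_transition t a b
  refine ⟨h.summable, ?_⟩
  rw [h.tsum_eq]
  have hd := hasDerivAt_exp_smul_const (𝕂 := ℝ) hQ.generator (t : ℝ)
  have hd2 := ((ellOne.eval b).comp
    (ContinuousLinearMap.apply ℝ (ellOne S) (ellOne.unit a))).hasFDerivAt.comp_hasDerivAt _ hd
  refine hd2.hasDerivWithinAt.congr (fun s hs => ?_) ?_
  · simp only [transition, Real.coe_toNNReal s hs]; rfl
  · simp only [transition, Real.toNNReal_coe]; rfl

theorem reversible_transition (hQ : IsBoundedQMatrix Q C) (w : S → ℝ)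
    (hw : ∀ a b, w a * Q a b = w b * Q b a) (t : ℝ≥0) (a b : S) :
    w a * hQ.transition t a b = w b * hQ.transition t b a := by
  have hpow : ∀ k : ℕ, ∀ a b, w a * (hQ.generator ^ k) (ellOne.unit a) b
      = w b * (hQ.generator ^ k) (ellOne.unit b) a := by
    classical
    intro k
    induction k with
    | zero =>
      intro a b
      simp only [pow_zero, one_apply_eq_self, ellOne.unit_apply]
      by_cases h : a = b
      · subst h; rfl
      · simp [h, Ne.symm h]
    | succ k ih =>
      intro a b
      have h1 := (ellOne.hasSum_map_apply (hQ.generator ^ k) (hQ.row a) b).mul_left (w a)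
      have h2 := (ellOne.hasSum_map_apply hQ.generator ((hQ.generator ^ k) (ellOne.unit b))
        a).mul_left (w b)
      -- The factor `Q` is split off on the left in the `(a, b)` entry and on the right in the `(b,
      -- a)` entry; the two sums over the intermediate state then agree term by term.
      rw [pow_succ, mul_apply_eq_comp, generator_unit, ← pow_succ, pow_succ',
        mul_apply_eq_comp]
      refine h1.unique ?_
      convert h2 using 2 with c
      rw [generator_unit, row_apply, row_apply, ← mul_assoc, hw, mul_right_comm, ih, mul_assoc]
  have h1 := (hasSum_exp_apply ((t : ℝ) • hQ.generator) (ellOne.eval b)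
    (ellOne.unit a)).mul_left (w a)
  have h2 := (hasSum_exp_apply ((t : ℝ) • hQ.generator) (ellOne.eval a)
    (ellOne.unit b)).mul_left (w b)
  refine h1.unique (h2.of_eq fun k => Eq.symm ?_)
  have := hpow k a b
  simp only [smul_pow, smul_apply, map_smul, smul_eq_mul]
  change w a * (_ * (_ * (hQ.generator ^ k) (ellOne.unit a) b))
    = w b * (_ * (_ * (hQ.generator ^ k) (ellOne.unit b) a))
  linear_combination ((k.factorial : ℝ)⁻¹ * (t : ℝ) ^ k) * this

/-- Picard iteration: the difference of two solutions vanishes at time `0`, is at most `1` in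
absolute value, and its derivative is at most `2C` times its supremum over the starting state.
Iterating yields the bound `(2Ct)^k / k!` for every `k`. -/
theorem eq_of_solvesBackward (hQ : IsBoundedQMatrix Q C) {P P' : ℝ≥0 → S → S → ℝ}
    (hP : IsMarkovSemigroup P) (hPQ : SolvesBackward Q P)
    (hP' : IsMarkovSemigroup P') (hPQ' : SolvesBackward Q P') : P = P' := by
  have hle : ∀ {R : ℝ≥0 → S → S → ℝ}, IsMarkovSemigroup R → ∀ t a b, R t a b ≤ 1 :=
    fun hR t a b => le_hasSum (hR.hasSum_one t a) b (fun c _ => hR.nonneg t a c)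
  set D : ℝ≥0 → S → S → ℝ := fun t a b => P t a b - P' t a b with hD
  have hDle : ∀ t a b, ‖D t a b‖ ≤ 1 := fun t a b => by
    rw [Real.norm_eq_abs, abs_le]
    constructor <;>
    linarith [hle hP t a b, hle hP' t a b, hP.nonneg t a b, hP'.nonneg t a b]
  have hDd : ∀ (t : ℝ≥0) a b,
      HasDerivWithinAt (fun s : ℝ => D s.toNNReal a b) (∑' c, Q a c * D t c b)
        (Set.Ici 0) (t : ℝ) := fun t a b => by
    have := (hPQ t a b).2.sub (hPQ' t a b).2
    rw [← (hPQ t a b).1.tsum_sub (hPQ' t a b).1] at this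
    simp only [hD, mul_sub]
    exact this
  have hC : ∀ a : S, 0 ≤ C := fun a => by
    have := (hQ.hasSum_norm a).nonneg (fun _ => norm_nonneg _)
    linarith [hQ.neg_diag_le a]
  have hsum : ∀ (a b : S) (t : ℝ≥0) (B : ℝ), (∀ c, ‖D t c b‖ ≤ B) →
      ‖∑' c, Q a c * D t c b‖ ≤ 2 * C * B := fun a b t B hB => by
    have hB0 : 0 ≤ B := (norm_nonneg _).trans (hB a)
    have hs := (hQ.hasSum_norm a).mul_right B
    refine (tsum_of_norm_bounded hs fun c => ?_).trans ?_
    · rw [norm_mul]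
      exact mul_le_mul_of_nonneg_left (hB c) (norm_nonneg _)
    · exact mul_le_mul_of_nonneg_right (by linarith [hQ.neg_diag_le a]) hB0
  have key : ∀ k : ℕ, ∀ (t : ℝ≥0) a b, ‖D t a b‖ ≤ (2 * C * t) ^ k / k.factorial := by
    intro k
    induction k with
    | zero => intro t a b; simpa using hDle t a b
    | succ k ih =>
      intro t a b
      have hcont : ContinuousOn (fun s : ℝ => D s.toNNReal a b) (Set.Icc 0 (t : ℝ)) := by
        intro s hs
        have := (hDd s.toNNReal a b).continuousWithinAt
        rw [Real.coe_toNNReal s hs.1] at this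
        exact this.mono Set.Icc_subset_Ici_self
      -- The bound for `k + 1` is the primitive, vanishing at `0`, of `2C` times the bound for `k`.
      have := image_norm_le_of_norm_deriv_right_le_deriv_boundary (a := 0) (b := (t : ℝ))
        (f' := fun s => ∑' c, Q a c * D s.toNNReal c b)
        (B := fun s => (2 * C * s) ^ (k + 1) / (k + 1).factorial)
        (B' := fun s => 2 * C * ((2 * C * s) ^ k / k.factorial)) hcont
        (fun s hs => by
          have := hDd s.toNNReal a b
          rw [Real.coe_toNNReal s hs.1] at this
          exact this.mono (Set.Ici_subset_Ici.2 hs.1))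
        (by simp [hD, hP.zero, hP'.zero])
        (fun s => by
          have h := (((hasDerivAt_id s).const_mul (2 * C)).pow (k + 1)).div_const
            ((k + 1).factorial : ℝ)
          refine h.congr_deriv ?_
          rw [Nat.factorial_succ]
          have : (k.factorial : ℝ) ≠ 0 := by positivity
          have : ((k : ℝ) + 1) ≠ 0 := by positivity
          push_cast
          simp only [id]
          field_simp)
        (fun s hs => hsum a b _ _ fun c => by
          simpa [Real.coe_toNNReal s hs.1] using ih s.toNNReal c b)
        (x := (t : ℝ)) ⟨t.2, le_rfl⟩
      simpa using this
  funext t a b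
  have h0 : ‖D t a b‖ ≤ 0 :=
    ge_of_tendsto' (FloorSemiring.tendsto_pow_div_factorial_atTop (2 * C * (t : ℝ)))
      fun k => key k t a b
  have := norm_le_zero_iff.1 h0
  exact sub_eq_zero.1 this

end IsBoundedQMatrix

end BoundedGenerator

/-! ### Kolmogorov extension over a countable state space. -/

section KolmogorovExtension

open MeasureTheory Filter Topology

theorem MeasureTheory.Measure.exists_finset_measure_compl_lt {T : Type*} [Countable T]
    [MeasurableSpace T] [MeasurableSingletonClass T] (μ : Measure T) [IsFiniteMeasure μ]
    {ε : ℝ≥0∞} (hε : 0 < ε) : ∃ F : Finset T, μ (F : Set T)ᶜ < ε := by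
  have hsum : ∑' x, μ {x} ≠ ∞ := by
    have := measure_iUnion (μ := μ) (f := fun x : T => {x})
      (fun a b h => by simpa [Function.onFun] using h) (fun x => measurableSet_singleton x)
    rw [← this]
    finiteness
  obtain ⟨F, hF⟩ := ((ENNReal.tendsto_tsum_compl_atTop_zero hsum).eventually_lt_const hε).exists
  refine ⟨F, lt_of_le_of_lt ?_ hF⟩
  refine (measure_mono fun x hx => ?_).trans
    (measure_iUnion_le (fun b : {x // x ∉ F} => ({b.1} : Set T)))
  exact Set.mem_iUnion.2 ⟨⟨x, hx⟩, rfl⟩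

variable {ι S : Type*} [Countable S] [MeasurableSpace S] [MeasurableSingletonClass S]

/-- Continuity at `∅` of the content of a projective family on a countable state space. -/
theorem tendsto_projectiveFamilyContent_of_countable
    {P : ∀ J : Finset ι, Measure (∀ _ : J, S)} [∀ J, IsProbabilityMeasure (P J)]
    (hP : IsProjectiveMeasureFamily (α := fun _ : ι => S) P) {A : ℕ → Set (ι → S)}
    (hA : ∀ n, A n ∈ measurableCylinders fun _ : ι => S) (hanti : Antitone A)
    (hempty : ⋂ n, A n = ∅) :
    Tendsto (fun n => projectiveFamilyContent hP (A n)) atTop (𝓝 0) := by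
  classical
  have hmono : Antitone fun n => projectiveFamilyContent hP (A n) := fun i j hij =>
    projectiveFamilyContent_mono hP (hA j) (hA i) (hanti hij)
  by_contra hcon
  have hinf : 0 < ⨅ n, projectiveFamilyContent hP (A n) := by
    refine pos_iff_ne_zero.2 fun h0 => hcon ?_
    rw [← h0]
    exact tendsto_atTop_iInf hmono
  choose J B hB hAB using fun n => (mem_measurableCylinders _).1 (hA n)
  set T : Set ι := ⋃ n, (J n : Set ι) with hT
  have hTc : Countable T := (Set.countable_iUnion fun n => (J n).countable_toSet).to_subtype
  -- Countably many coordinates determine all `A n`. They receive error budgets with sum below the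
  -- infimum of the contents, and each a finite set `F i` that its marginal misses with less than
  -- its budget.
  obtain ⟨δ, hδ, hδsum⟩ := ENNReal.exists_pos_sum_of_countable' hinf.ne' T
  have hmarg : ∀ i : ι, ∃ F : Finset S,
      ∀ h : i ∈ T, P {i} {g | g ⟨i, Finset.mem_singleton_self i⟩ ∉ F} < δ ⟨i, h⟩ := fun i => by
    by_cases h : i ∈ T
    · have hm : Measurable fun g : (∀ _ : ({i} : Finset ι), S) =>
          g ⟨i, Finset.mem_singleton_self i⟩ := measurable_pi_apply _
      have := Measure.isProbabilityMeasure_map (μ := P {i}) hm.aemeasurable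
      obtain ⟨F, hF⟩ := Measure.exists_finset_measure_compl_lt ((P {i}).map fun g =>
          g ⟨i, Finset.mem_singleton_self i⟩) (hδ ⟨i, h⟩)
      rw [Measure.map_apply hm (Set.to_countable _).measurableSet] at hF
      exact ⟨F, fun _ => hF⟩
    · exact ⟨∅, fun h' => absurd h' h⟩
  choose F hF using hmarg
  -- Otherwise the base of the cylinder `A n` would be covered by the exceptional sets, whose total
  -- mass is smaller than the content of `A n`.
  have hall : ∀ n, ∃ f ∈ A n, ∀ i ∈ J n, f i ∈ F i := by
    intro n
    by_contra! hno
    have hne : Nonempty (ι → S) := by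
      by_contra hem
      rw [not_nonempty_iff] at hem
      have : P (J n) Set.univ = 0 := by rw [hP.eq_zero_of_isEmpty]; simp
      simp at this
    have hsub : B n ⊆ ⋃ i : J n, {g | g i ∉ F i} := by
      intro g hg
      set f : ι → S := fun i => if h : i ∈ J n then g ⟨i, h⟩ else hne.some i with hf
      have hfg : (J n).restrict f = g := by
        ext i; simp [hf]
      have hfA : f ∈ A n := by
        rw [hAB n, mem_cylinder, hfg]; exact hg
      obtain ⟨i, hi, hiF⟩ := hno f hfA
      refine Set.mem_iUnion.2 ⟨⟨i, hi⟩, ?_⟩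
      simpa [hf, hi] using hiF
    have hle : projectiveFamilyContent hP (A n) ≤ ∑' i : T, δ i := by
      rw [projectiveFamilyContent_congr hP _ (hAB n) (hB n)]
      refine (measure_mono hsub).trans ((measure_iUnion_le _).trans ?_)
      have hJT : ∀ i : J n, (i : ι) ∈ T := fun i => Set.mem_iUnion.2 ⟨n, i.2⟩
      have hinj : Function.Injective fun i : J n => (⟨i, hJT i⟩ : T) := fun a b h =>
        Subtype.ext (congrArg (fun x : T => (x : ι)) h)
      refine le_trans (ENNReal.tsum_le_tsum fun i => ?_)
        (ENNReal.tsum_comp_le_tsum_of_injective hinj δ)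
      have h1 := hP (J n) {(i : ι)} (by simp)
      have h2 := hF i (hJT i)
      rw [h1, Measure.map_apply (Finset.measurable_restrict₂ (X := fun _ : ι => S) _)
        (Set.to_countable _).measurableSet] at h2
      exact h2.le
    exact absurd (hle.trans_lt hδsum) (not_lt.2 (iInf_le _ n))
  let _ : TopologicalSpace S := ⊥
  have _ : DiscreteTopology S := ⟨rfl⟩
  obtain ⟨f₀, -, -⟩ := hall 0
  -- With the discrete topology on `S`, cylinders are closed and this product of finite sets is
  -- compact. Including `f₀ i` allows points of `A n` to be reset to `f₀` outside `J n`, where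
  -- membership in `A n` does not look; Cantor's intersection theorem then contradicts `hempty`.
  set K : Set (ι → S) := Set.univ.pi fun i => insert (f₀ i) (F i : Set S) with hK
  have hKc : IsCompact K :=
    isCompact_univ_pi fun i => ((F i).finite_toSet.insert _).isCompact
  have hclosed : ∀ n, IsClosed (A n) := fun n => by
    rw [hAB n]
    exact (isClosed_discrete (B n)).preimage (by unfold Finset.restrict; fun_prop)
  have hne : ∀ n, (A n ∩ K).Nonempty := fun n => by
    obtain ⟨f, hfA, hfF⟩ := hall n
    refine ⟨fun i => if i ∈ J n then f i else f₀ i, ?_, ?_⟩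
    · rw [hAB n, mem_cylinder] at hfA ⊢
      convert hfA using 1
      ext i
      simp
    · intro i _
      by_cases h : i ∈ J n
      · simpa [h] using Or.inr (hfF i h)
      · simp [h]
  have := IsCompact.nonempty_iInter_of_sequence_nonempty_isCompact_isClosed
    (fun n => A n ∩ K) (fun n => Set.inter_subset_inter_left _ (hanti (Nat.le_succ n))) hne
    (hKc.inter_left (hclosed 0)) (fun n => (hclosed n).inter hKc.isClosed)
  obtain ⟨f, hf⟩ := this
  have : f ∈ ⋂ n, A n := Set.mem_iInter.2 fun n => (Set.mem_iInter.1 hf n).1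
  simp [hempty] at this

/-- Kolmogorov's extension theorem for a countable state space. -/
theorem exists_isProjectiveLimit_of_countable
    {P : ∀ J : Finset ι, Measure (∀ _ : J, S)} [∀ J, IsProbabilityMeasure (P J)]
    (hP : IsProjectiveMeasureFamily (α := fun _ : ι => S) P) :
    ∃ μ : Measure (ι → S), IsProjectiveLimit (α := fun _ : ι => S) μ P := by
  -- Continuity at `∅` upgrades finite additivity on the ring of cylinders to countable additivity,
  -- so that Carathéodory's extension applies.
  have hsub : (projectiveFamilyContent hP).IsSigmaSubadditive := by
    refine isSigmaSubadditive_of_addContent_iUnion_eq_tsum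
      isSetRing_measurableCylinders fun f hf hf_Union hf' => ?_
    exact addContent_iUnion_eq_sum_of_tendsto_zero isSetRing_measurableCylinders _
      (fun _ _ => projectiveFamilyContent_ne_top hP)
      (fun s hs hanti hinter => tendsto_projectiveFamilyContent_of_countable hP hs hanti hinter)
      hf hf_Union hf'
  refine ⟨(projectiveFamilyContent hP).measure isSetSemiring_measurableCylinders
    generateFrom_measurableCylinders.ge hsub, fun I => ?_⟩
  ext s hs
  rw [Measure.map_apply (Finset.measurable_restrict I) hs, AddContent.measure_eq,
    projectiveFamilyContent_congr hP (I.restrict ⁻¹' s) rfl hs]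
  · exact generateFrom_measurableCylinders.symm
  · exact cylinder_mem_measurableCylinders _ _ hs

end KolmogorovExtension

/-! ### From a Markov semigroup to a Markov process. -/

namespace IsMarkovSemigroup

variable {S : Type*} {P : ℝ≥0 → S → S → ℝ}

/-- The law at time `t` of the Markov process started in `a`. -/
def law (hP : IsMarkovSemigroup P) (t : ℝ≥0) (a : S) : PMF S :=
  ⟨fun b => ENNReal.ofReal (P t a b), by
    have h := hP.hasSum_one t a
    have h2 := ENNReal.ofReal_tsum_of_nonneg (hP.nonneg t a) h.summable
    rw [h.tsum_eq, ENNReal.ofReal_one] at h2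
    rw [h2]
    exact ENNReal.summable.hasSum⟩

theorem law_apply (hP : IsMarkovSemigroup P) (t : ℝ≥0) (a b : S) :
    hP.law t a b = ENNReal.ofReal (P t a b) := rfl

theorem law_zero (hP : IsMarkovSemigroup P) (a : S) : hP.law 0 a = PMF.pure a := by
  classical
  ext b
  rw [law_apply, hP.zero, PMF.pure_apply]
  by_cases h : a = b
  · simp [h]
  · simp [h, Ne.symm h]

theorem law_bind_law (hP : IsMarkovSemigroup P) (s t : ℝ≥0) (a : S) :
    (hP.law s a).bind (hP.law t) = hP.law (s + t) a := by
  ext b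
  have h := hP.add s t a b
  rw [PMF.bind_apply, law_apply, ← h.tsum_eq, ENNReal.ofReal_tsum_of_nonneg
    (fun c => mul_nonneg (hP.nonneg _ _ _) (hP.nonneg _ _ _)) h.summable]
  exact tsum_congr fun c => by rw [law_apply, law_apply, ENNReal.ofReal_mul (hP.nonneg _ _ _)]

/-- The joint law of the positions of the Markov process at the times in the (sorted) list, when
it is in `a` at time `s`. It is recorded as the law of a function of time, with the value `o`
at all times that are not in the list. -/
def pathLaw (hP : IsMarkovSemigroup P) (o : S) : List ℝ≥0 → ℝ≥0 → S → PMF (ℝ≥0 → S)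
  | [], _, _ => PMF.pure fun _ => o
  | t :: l, s, a => (hP.law (t - s) a).bind fun b =>
      (pathLaw hP o l t b).map fun f => Function.update f t b

variable (hP : IsMarkovSemigroup P) (o : S)

theorem pathLaw_cons (t : ℝ≥0) (l : List ℝ≥0) (s : ℝ≥0) (a : S) :
    hP.pathLaw o (t :: l) s a = (hP.law (t - s) a).bind fun b =>
      (hP.pathLaw o l t b).map fun f => Function.update f t b := rfl

theorem pathLaw_cons_self (t : ℝ≥0) (l : List ℝ≥0) (a : S) :
    hP.pathLaw o (t :: l) t a = (hP.pathLaw o l t a).map fun f => Function.update f t a := by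
  rw [pathLaw_cons, tsub_self, law_zero, PMF.pure_bind]

/-- Chapman–Kolmogorov: stopping at an unrecorded intermediate time changes nothing. -/
theorem law_bind_pathLaw {s t : ℝ≥0} (hst : s ≤ t) (l : List ℝ≥0) (hl : ∀ u ∈ l, t ≤ u) (a : S) :
    (hP.law (t - s) a).bind (hP.pathLaw o l t) = hP.pathLaw o l s a := by
  cases l with
  | nil => exact PMF.bind_const _ _
  | cons u l =>
    have htu := hl u (by simp)
    have : hP.pathLaw o (u :: l) t = fun b => (hP.law (u - t) b).bind fun c =>
      (hP.pathLaw o l u c).map fun f => Function.update f u c := rfl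
    rw [this, ← PMF.bind_bind, law_bind_law, pathLaw_cons, add_comm, tsub_add_tsub_cancel htu hst]

/-- Consistency of the finite-dimensional laws. A time missing from the shorter list is not observed
by `J` and is integrated out; a common time is split off, and the induction continues with that time
erased from `J`. -/
theorem map_restrict_pathLaw {l l' : List ℝ≥0} (hll : l.Sublist l') :
    ∀ (s : ℝ≥0) (a : S) (J : Finset ℝ≥0), (∀ u ∈ J, u ∈ l) → (s :: l').Pairwise (· ≤ ·) →
      l'.Nodup → (hP.pathLaw o l' s a).map (J.restrict (π := fun _ => S))
        = (hP.pathLaw o l s a).map (J.restrict (π := fun _ => S)) := by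
  induction hll with
  | slnil => intros; rfl
  | @cons l l' t hll ih =>
    intro s a J hJ hsort hnd
    rw [List.pairwise_cons] at hsort
    rw [List.nodup_cons] at hnd
    have htJ : t ∉ J := fun h => hnd.1 (hll.subset (hJ t h))
    have hcomp : ∀ b : S, J.restrict (π := fun _ => S) ∘ (fun f => Function.update f t b)
        = J.restrict (π := fun _ => S) := fun b => by
      funext f i
      have : (i : ℝ≥0) ≠ t := fun h => htJ (h ▸ i.2)
      simp [this]
    rw [pathLaw_cons, PMF.map_bind]
    simp only [PMF.map_comp, hcomp, ih t _ J hJ hsort.2 hnd.2]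
    rw [← PMF.map_bind, law_bind_pathLaw hP o (hsort.1 t (by simp)) l
      (fun u hu => (List.pairwise_cons.1 hsort.2).1 u (hll.subset hu))]
  | @cons_cons l l' t hll ih =>
    intro s a J hJ hsort hnd
    rw [List.pairwise_cons] at hsort
    rw [List.nodup_cons] at hnd
    set φ : S → (∀ _ : J.erase t, S) → (∀ _ : J, S) := fun b g j =>
      if h : (j : ℝ≥0) = t then b else g ⟨j, Finset.mem_erase.2 ⟨h, j.2⟩⟩ with hφ
    have hcomp : ∀ b : S, J.restrict (π := fun _ => S) ∘ (fun f => Function.update f t b)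
        = φ b ∘ (J.erase t).restrict (π := fun _ => S) := fun b => by
      funext f i
      by_cases h : (i : ℝ≥0) = t
      · simp [hφ, h]
      · simp [hφ, h]
    rw [pathLaw_cons, PMF.map_bind, pathLaw_cons, PMF.map_bind]
    simp only [PMF.map_comp, hcomp]
    simp only [← PMF.map_comp]
    have hJ' : ∀ u ∈ J.erase t, u ∈ l := fun u hu => by
      have := hJ u (Finset.mem_of_mem_erase hu)
      exact (List.mem_cons.1 this).resolve_left (Finset.ne_of_mem_erase hu)
    simp only [ih t _ (J.erase t) hJ' hsort.2 hnd.2]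

/-- `IsMarkovProcess.finiteDim` allows repeated times, while a sorted finite set has none. A
repetition is a step of length `0`, which stays put. -/
theorem pathLaw_dedup (l : List ℝ≥0) : ∀ (s : ℝ≥0) (a : S), (s :: l).Pairwise (· ≤ ·) →
    hP.pathLaw o l.dedup s a = hP.pathLaw o l s a := by
  induction l with
  | nil => intros; rfl
  | cons t l ih =>
    intro s a hsort
    rw [List.pairwise_cons] at hsort
    by_cases ht : t ∈ l
    · rw [List.dedup_cons_of_mem ht]
      cases l with
      | nil => simp at ht
      | cons u l =>
        have h2 := List.pairwise_cons.1 hsort.2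
        have htu : t = u := by
          rcases List.mem_cons.1 ht with h | h
          · exact h
          · exact le_antisymm (h2.1 u (by simp)) ((List.pairwise_cons.1 h2.2).1 t h)
        subst htu
        rw [ih s a (List.pairwise_cons.2 ⟨fun v hv => hsort.1 v (by simp [List.mem_cons.1 hv]),
          h2.2⟩), pathLaw_cons, pathLaw_cons]
        congr 1
        funext b
        rw [pathLaw_cons_self, PMF.map_comp]
        congr 1
        funext f
        simp
    · rw [List.dedup_cons_of_notMem ht, pathLaw_cons, pathLaw_cons]
      simp only [ih t _ hsort.2]

theorem apply_eq_of_mem_support_pathLaw {t : ℝ≥0} {l : List ℝ≥0} (hl : (t :: l).Pairwise (· ≤ ·))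
    (ht : t ∈ l) {b : S} {f : ℝ≥0 → S} (hf : f ∈ (hP.pathLaw o l t b).support) : f t = b := by
  cases l with
  | nil => simp at ht
  | cons u l =>
    have h2 := List.pairwise_cons.1 hl
    have htu : t = u := by
      rcases List.mem_cons.1 ht with h | h
      · exact h
      · exact le_antisymm (h2.1 u (by simp)) ((List.pairwise_cons.1 h2.2).1 t h)
    subst htu
    rw [pathLaw_cons_self, PMF.mem_support_map_iff] at hf
    obtain ⟨g, -, rfl⟩ := hf
    simp

theorem pathLaw_cons_event {n : ℕ} (t : ℝ≥0) (τ : Fin n → ℝ≥0)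
    (hτ : (t :: List.ofFn τ).Pairwise (· ≤ ·)) (s : ℝ≥0) (a b : S) (c : Fin n → S) :
    (hP.pathLaw o (t :: List.ofFn τ) s a).toOuterMeasure {f | f t = b ∧ ∀ i, f (τ i) = c i}
      = hP.law (t - s) a b *
        (hP.pathLaw o (List.ofFn τ) t b).toOuterMeasure {f | ∀ i, f (τ i) = c i} := by
  rw [pathLaw_cons, PMF.toOuterMeasure_bind_apply, tsum_eq_single b]
  · congr 1
    rw [PMF.toOuterMeasure_map_apply]
    refine PMF.toOuterMeasure_apply_eq_of_inter_support_eq _ ?_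
    ext f
    simp only [Set.mem_inter_iff, Set.mem_preimage, Set.mem_ofPred_eq, Function.update_self,
      true_and]
    refine and_congr_left fun hf => forall_congr' fun i => ?_
    -- If `t` occurs again in the tail, the update at `t` overwrites a recorded value; on the
    -- support that value is already `b`.
    by_cases h : τ i = t
    · rw [h, Function.update_self, apply_eq_of_mem_support_pathLaw hP o hτ
        (h ▸ (List.mem_ofFn.2 ⟨i, rfl⟩)) hf]
    · rw [Function.update_of_ne h]
  · intro b' hb'
    rw [PMF.toOuterMeasure_map_apply]
    have : (fun f : ℝ≥0 → S => Function.update f t b') ⁻¹'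
        {f | f t = b ∧ ∀ i, f (τ i) = c i} = ∅ := by
      ext f
      simp [hb']
    simp [this]

theorem pathLaw_ofFn_event (k : ℕ) : ∀ (τ : Fin (k + 1) → ℝ≥0) (s : ℝ≥0) (x : S)
    (a : Fin (k + 1) → S), Monotone τ →
    (hP.pathLaw o (List.ofFn τ) s x).toOuterMeasure {f | ∀ i, f (τ i) = a i}
      = hP.law (τ 0 - s) x (a 0) *
        ∏ i : Fin k, hP.law (τ i.succ - τ i.castSucc) (a i.castSucc) (a i.succ) := by
  induction k with
  | zero =>
    intro τ s x a hτ
    have h := hP.pathLaw_cons_event o (τ 0) (fun i : Fin 0 => τ i.succ) (by simp) s x (a 0)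
      (fun i => a i.succ)
    rw [List.ofFn_succ]
    simp only [Fin.forall_fin_succ (n := 0)]
    rw [h]
    have hu : (hP.pathLaw o [] (τ 0) (a 0)).toOuterMeasure Set.univ = 1 :=
      (PMF.toOuterMeasure_apply_eq_one_iff _ _).2 (Set.subset_univ _)
    simp [hu]
  | succ k ih =>
    intro τ s x a hτ
    have hmono : Monotone fun i : Fin (k + 1) => τ i.succ := fun i j hij =>
      hτ (Fin.succ_le_succ_iff.2 hij)
    have hsort : (τ 0 :: List.ofFn fun i : Fin (k + 1) => τ i.succ).Pairwise (· ≤ ·) := by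
      rw [← List.ofFn_succ]
      exact (List.sortedLE_ofFn_iff.2 hτ).pairwise
    have h := hP.pathLaw_cons_event o (τ 0) (fun i : Fin (k + 1) => τ i.succ) hsort s x (a 0)
      (fun i => a i.succ)
    rw [List.ofFn_succ]
    simp only [Fin.forall_fin_succ (n := k + 1)]
    rw [h, ih _ _ _ (fun i => a i.succ) hmono, Fin.prod_univ_succ]
    rfl

-- The coordinate process on path space. Each finite set of times gets the path law along its sorted
-- list, started at time `0` from `μ`; the state `o` only fills unrecorded times.
open MeasureTheory in
theorem exists_isMarkovProcess {S : Type} [Countable S] [MeasurableSpace S]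
    [MeasurableSingletonClass S] {P : ℝ≥0 → S → S → ℝ} (hP : IsMarkovSemigroup P) (μ : PMF S) :
    ∃ (Ω : Type) (_ : MeasurableSpace Ω) (ℙ : Measure Ω) (X : ℝ≥0 → Ω → S),
      IsMarkovProcess P μ ℙ X := by
  classical
  obtain ⟨o, -⟩ := μ.support_nonempty
  set p : Finset ℝ≥0 → PMF (ℝ≥0 → S) := fun J => μ.bind (hP.pathLaw o J.sort 0) with hp
  set R : ∀ J : Finset ℝ≥0, Measure (∀ _ : J, S) := fun J =>
    ((p J).map (J.restrict (π := fun _ => S))).toMeasure with hR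
  have hproj : IsProjectiveMeasureFamily (α := fun _ : ℝ≥0 => S) R := fun I J hJI => by
    have hsub : (J.sort).Sublist I.sort := by
      refine List.sublist_of_subperm_of_pairwise ?_ (J.pairwise_sort (· ≤ ·))
        (I.pairwise_sort (· ≤ ·))
      exact (J.sort_nodup _).subperm fun u hu => by
        rw [Finset.mem_sort] at hu ⊢; exact hJI hu
    have h1 : (p J).map (J.restrict (π := fun _ => S))
        = (p I).map (J.restrict (π := fun _ => S)) := by
      simp only [hp, PMF.map_bind]
      congr 1
      funext a
      exact (hP.map_restrict_pathLaw o hsub 0 a J (fun u hu => by simpa using hu)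
        (List.pairwise_cons.2 ⟨fun _ _ => zero_le, I.pairwise_sort (· ≤ ·)⟩)
        (I.sort_nodup _)).symm
    simp only [hR]
    rw [h1]
    refine Eq.trans ?_ (PMF.toMeasure_map _ _
      (Finset.measurable_restrict₂ (X := fun _ : ℝ≥0 => S) hJI)).symm
    rw [PMF.map_comp]
    rfl
  obtain ⟨ν, hν⟩ := exists_isProjectiveLimit_of_countable hproj
  refine ⟨ℝ≥0 → S, inferInstance, ν, fun t ω => ω t, hν.isProbabilityMeasure,
    fun t => measurable_pi_apply t, fun k τ hτ0 hτ a => ?_⟩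
  set J : Finset ℝ≥0 := Finset.univ.image τ with hJ
  have hmem : ∀ i, τ i ∈ J := fun i => Finset.mem_image_of_mem τ (Finset.mem_univ i)
  have hset : {ω : ℝ≥0 → S | ∀ i, ω (τ i) = a i}
      = J.restrict (π := fun _ => S) ⁻¹' {g | ∀ i, g ⟨τ i, hmem i⟩ = a i} := by
    ext ω; simp
  have hsorted : (List.ofFn τ).Pairwise (· ≤ ·) := (List.sortedLE_ofFn_iff.2 hτ).pairwise
  have hsort : J.sort = (List.ofFn τ).dedup := by
    have : J = (List.ofFn τ).dedup.toFinset := by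
      ext u
      rw [List.mem_toFinset, List.mem_dedup, List.mem_ofFn, hJ, Finset.mem_image]
      simp
    rw [this]
    exact (List.toFinset_sort (· ≤ ·) (List.nodup_dedup _)).2
      (hsorted.sublist (List.dedup_sublist _))
  have hpath : hP.pathLaw o J.sort 0 = hP.pathLaw o (List.ofFn τ) 0 := by
    funext x
    rw [hsort, hP.pathLaw_dedup o _ 0 x (List.pairwise_cons.2 ⟨fun _ _ => zero_le, hsorted⟩)]
  have hms : MeasurableSet {g : (∀ _ : J, S) | ∀ i, g ⟨τ i, hmem i⟩ = a i} :=
    (Set.to_countable _).measurableSet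
  rw [hset, ← Measure.map_apply (Finset.measurable_restrict J) hms, hν J]
  simp only [hR]
  rw [PMF.toMeasure_apply_eq_toOuterMeasure_apply _ hms, PMF.toOuterMeasure_map_apply, ← hset]
  simp only [hp]
  -- As `τ 0 = 0` and the law at time `0` is a point mass, only the starting state `a 0`
  -- contributes.
  rw [PMF.toOuterMeasure_bind_apply, hpath, tsum_eq_single (a 0)]
  · rw [hP.pathLaw_ofFn_event o k τ 0 (a 0) a hτ, hτ0, tsub_self, law_zero,
      PMF.pure_apply_self, one_mul, ENNReal.ofReal_prod_of_nonneg fun i _ => hP.nonneg _ _ _]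
    rfl
  · intro b hb
    rw [hP.pathLaw_ofFn_event o k τ 0 b a hτ, hτ0, tsub_self, law_zero,
      PMF.pure_apply_of_ne _ _ hb.symm, zero_mul, mul_zero]

end IsMarkovSemigroup

/-! ### Gibbs weights when one customer joins or leaves. -/

section TableOccupations

/-- The Gibbs weight `∏_j (1 / r_j!) ((θ / j) e ^ j) ^ {r_j}` of the table occupation of one
restaurant. -/
def restaurantWeight (θ e : ℝ) (m : Multiset ℕ) : ℝ :=
  occupationWeight (fun j => θ / j * e ^ j) m

theorem occupationWeight_eq_prod (a : ℕ → ℝ) (m : Multiset ℕ) {s : Finset ℕ}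
    (hs : m.toFinset ⊆ s) :
    occupationWeight a m = ∏ j ∈ s, a j ^ m.count j / ((m.count j).factorial : ℝ) := by
  refine Finset.prod_subset hs fun j _ hj => ?_
  rw [Multiset.mem_toFinset] at hj
  simp [Multiset.count_eq_zero_of_notMem hj]

theorem occupationWeight_cons (a : ℕ → ℝ) (j : ℕ) (m : Multiset ℕ) :
    occupationWeight a (j ::ₘ m) * (m.count j + 1) = a j * occupationWeight a m := by
  have hj : j ∈ (j ::ₘ m).toFinset := by simp
  rw [occupationWeight_eq_prod a (j ::ₘ m) subset_rfl,
    occupationWeight_eq_prod a m (s := (j ::ₘ m).toFinset) (by simp),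
    ← Finset.mul_prod_erase _ _ hj, ← Finset.mul_prod_erase _ _ hj]
  have h : ∀ i ∈ ((j ::ₘ m).toFinset).erase j,
      a i ^ (j ::ₘ m).count i / (((j ::ₘ m).count i).factorial : ℝ)
        = a i ^ m.count i / ((m.count i).factorial : ℝ) := fun i hi => by
    rw [Multiset.count_cons_of_ne (Finset.ne_of_mem_erase hi)]
  rw [Finset.prod_congr rfl h, Multiset.count_cons_self, Nat.factorial_succ]
  have h1 : ((m.count j).factorial : ℝ) ≠ 0 := by positivity
  have h2 : (m.count j : ℝ) + 1 ≠ 0 := by positivity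
  push_cast
  field_simp
  ring

theorem occupationWeight_nonneg {a : ℕ → ℝ} (ha : ∀ j, 0 ≤ a j) (m : Multiset ℕ) :
    0 ≤ occupationWeight a m :=
  Finset.prod_nonneg fun j _ => div_nonneg (pow_nonneg (ha j) _) (by positivity)

theorem restaurantWeight_zero (θ e : ℝ) : restaurantWeight θ e 0 = 1 := by
  simp [restaurantWeight, occupationWeight]

/-- Numerator of the seating probability: `θ` for a new table, `k r_k` for the `k`-tables. -/
def joinWeight (θ : ℝ) (k : ℕ) (m : Multiset ℕ) : ℝ :=
  if k = 0 then θ else k * m.count k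

theorem joinProb_eq (θ : ℝ) (k : ℕ) (m : Multiset ℕ) :
    joinProb θ k m = joinWeight θ k m / (m.sum + θ) := by
  unfold joinProb joinWeight
  split_ifs <;> rfl

theorem count_addCustomer_succ (k : ℕ) (c : Multiset ℕ) :
    (addCustomer k c).count (k + 1) = c.count (k + 1) + 1 := by
  simp [addCustomer, Multiset.count_erase_of_ne]

/-- Balance for a single seat, the source of both the recursion for `h` and reversibility. Turning a
`k`-table into a `(k + 1)`-table replaces the factor `θ e^k / (k r_k)` by `θ e^{k+1} / ((k + 1)
r'_{k+1})`; a new table just contributes `θ e / r'_1`. -/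
theorem restaurantWeight_addCustomer (θ e : ℝ) {k : ℕ} {c : Multiset ℕ} (hc : 0 ∉ c)
    (hk : k = 0 ∨ k ∈ c) :
    restaurantWeight θ e (addCustomer k c) * ((k + 1 : ℕ) * (addCustomer k c).count (k + 1))
      = e * restaurantWeight θ e c * joinWeight θ k c := by
  unfold restaurantWeight
  rw [count_addCustomer_succ]
  rcases Nat.eq_zero_or_pos k with rfl | hpos
  · have h := occupationWeight_cons (fun j => θ / j * e ^ j) 1 c
    have : addCustomer 0 c = 1 ::ₘ c := by
      rw [addCustomer, Multiset.erase_of_notMem hc, add_comm, zero_add, Multiset.singleton_add]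
    rw [this]
    simp only [joinWeight, if_true]
    push_cast at h ⊢
    linear_combination h
  · have hmem := hk.resolve_left hpos.ne'
    -- Both occupations are compared with the one in which the chosen table is missing altogether.
    obtain ⟨c₀, rfl⟩ := Multiset.exists_cons_of_mem hmem
    have h1 := occupationWeight_cons (fun j => θ / j * e ^ j) (k + 1) c₀
    have h2 := occupationWeight_cons (fun j => θ / j * e ^ j) k c₀
    have : addCustomer k (k ::ₘ c₀) = (k + 1) ::ₘ c₀ := by
      rw [addCustomer, Multiset.erase_cons_head, add_comm, Multiset.singleton_add]
    rw [this, Multiset.count_cons_of_ne (by simp)]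
    simp only [joinWeight, hpos.ne', if_false, Multiset.count_cons_self]
    have hk0 : (k : ℝ) ≠ 0 := by exact_mod_cast hpos.ne'
    have hk1 : (k : ℝ) + 1 ≠ 0 := by positivity
    push_cast at h1 h2 ⊢
    have h1' := congrArg (fun z => ((k : ℝ) + 1) * z) h1
    have h2' := congrArg (fun z => (k : ℝ) * z) h2
    have e1 : ((k : ℝ) + 1) * (θ / (k + 1) * e ^ (k + 1) *
        occupationWeight (fun j => θ / j * e ^ j) c₀)
        = θ * e ^ (k + 1) * occupationWeight (fun j => θ / j * e ^ j) c₀ := by field_simp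
    have e2 : (k : ℝ) * (θ / k * e ^ k * occupationWeight (fun j => θ / j * e ^ j) c₀)
        = θ * e ^ k * occupationWeight (fun j => θ / j * e ^ j) c₀ := by field_simp
    rw [e1] at h1'
    rw [e2] at h2'
    linear_combination h1' - e * h2'

theorem sum_addCustomer {k : ℕ} {c : Multiset ℕ} (hk : k = 0 ∨ k ∈ c) :
    (addCustomer k c).sum = c.sum + 1 := by
  rcases Nat.eq_zero_or_pos k with rfl | hpos
  · by_cases h : 0 ∈ c
    · have := Multiset.sum_erase h
      simp [addCustomer] at this ⊢
      omega
    · simp [addCustomer, Multiset.erase_of_notMem h]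
  · have := Multiset.sum_erase (hk.resolve_left hpos.ne')
    simp only [addCustomer, Multiset.sum_add, Multiset.sum_singleton]
    omega

theorem zero_notMem_addCustomer {k : ℕ} {c : Multiset ℕ} (hc : 0 ∉ c) : 0 ∉ addCustomer k c := by
  simp only [addCustomer, Multiset.mem_add, Multiset.mem_singleton, not_or]
  exact ⟨fun h => hc (Multiset.mem_of_mem_erase h), by omega⟩

theorem zero_notMem_removeCustomer {j : ℕ} {m : Multiset ℕ} (hm : 0 ∉ m) :
    0 ∉ removeCustomer j m := by
  unfold removeCustomer
  split_ifs with h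
  · simpa using fun h => hm (Multiset.mem_of_mem_erase h)
  · simp only [Multiset.mem_add, Multiset.mem_singleton, not_or]
    exact ⟨fun h => hm (Multiset.mem_of_mem_erase h), by omega⟩

theorem pred_mem_removeCustomer (j : ℕ) (m : Multiset ℕ) :
    j - 1 = 0 ∨ j - 1 ∈ removeCustomer j m := by
  unfold removeCustomer
  split_ifs with h
  · left; omega
  · right; simp

/-- With its converse below, this makes pairs (occupation, table left) correspond to pairs (smaller
occupation, seat taken). A customer leaving a `1`-table returns through option `0`, a new table. -/
theorem addCustomer_removeCustomer {j : ℕ} {m : Multiset ℕ} (hm : 0 ∉ m) (hj : j ∈ m) :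
    addCustomer (j - 1) (removeCustomer j m) = m := by
  have hpos : 0 < j := Nat.pos_of_ne_zero fun h => hm (h ▸ hj)
  unfold addCustomer
  rw [Nat.sub_add_cancel hpos]
  have hr : (removeCustomer j m).erase (j - 1) = m.erase j := by
    unfold removeCustomer
    split_ifs with h
    · have : j - 1 = 0 := by omega
      rw [this, add_zero, Multiset.erase_of_notMem]
      exact fun h => hm (Multiset.mem_of_mem_erase h)
    · rw [add_comm, Multiset.singleton_add, Multiset.erase_cons_head]
  rw [hr, add_comm, Multiset.singleton_add, Multiset.cons_erase hj]

theorem removeCustomer_addCustomer {k : ℕ} {c : Multiset ℕ} (hc : 0 ∉ c) (hk : k = 0 ∨ k ∈ c) :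
    removeCustomer (k + 1) (addCustomer k c) = c := by
  have h1 : (addCustomer k c).erase (k + 1) = c.erase k := by
    rw [addCustomer, add_comm, Multiset.singleton_add, Multiset.erase_cons_head]
  rw [removeCustomer, h1]
  rcases Nat.eq_zero_or_pos k with rfl | hpos
  · simp [Multiset.erase_of_notMem hc]
  · have : ¬ k + 1 ≤ 1 := by omega
    rw [if_neg this, Nat.add_sub_cancel, add_comm, Multiset.singleton_add,
      Multiset.cons_erase (hk.resolve_left hpos.ne')]

theorem sum_removeCustomer {j : ℕ} {m : Multiset ℕ} (hm : 0 ∉ m) (hj : j ∈ m) :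
    (removeCustomer j m).sum + 1 = m.sum := by
  rw [← sum_addCustomer (pred_mem_removeCustomer j m), addCustomer_removeCustomer hm hj]

theorem succ_mem_addCustomer (k : ℕ) (c : Multiset ℕ) : k + 1 ∈ addCustomer k c := by
  simp [addCustomer]

theorem sum_toFinset_mul_count (m : Multiset ℕ) :
    ∑ j ∈ m.toFinset, (j * m.count j : ℝ) = m.sum := by
  rw [Finset.sum_multiset_count m]
  push_cast
  exact Finset.sum_congr rfl fun j _ => by simp [mul_comm]

theorem sum_insert_joinWeight (θ : ℝ) {m : Multiset ℕ} (hm : 0 ∉ m) :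
    ∑ k ∈ insert 0 m.toFinset, joinWeight θ k m = m.sum + θ := by
  rw [Finset.sum_insert (by simpa using hm), add_comm, ← sum_toFinset_mul_count]
  congr 1
  refine Finset.sum_congr rfl fun k hk => ?_
  have : k ≠ 0 := fun h => hm (by simpa [h] using hk)
  simp [joinWeight, this]

end TableOccupations

/-! ### The recursion for `h_m` and the explicit exit rate. -/

section ExitRate

theorem Nat.Partition.zero_notMem {m : ℕ} (p : m.Partition) : 0 ∉ p.parts :=
  fun h => lt_irrefl _ (p.parts_pos h)

theorem hCoeff_eq (θ : ℝ) (m : ℕ) :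
    hCoeff (fun _ => θ) m = ∑ p : Nat.Partition m, restaurantWeight θ 1 p.parts := by
  simp [hCoeff, restaurantWeight]

/-- Double counting: partitions of `m + 1` with a marked part `j`, weighted by `j r_j` (total `m +
1`), against partitions of `m` with a seating option, weighted by `joinWeight` (total `m + θ`).
Removing and adding a customer are inverse bijections, and the weights match by
`restaurantWeight_addCustomer` with `e = 1`. -/
theorem hCoeff_succ (θ : ℝ) (m : ℕ) :
    (m + 1) * hCoeff (fun _ => θ) (m + 1) = (m + θ) * hCoeff (fun _ => θ) m := by
  rw [hCoeff_eq, hCoeff_eq, Finset.mul_sum, Finset.mul_sum]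
  have h1 : ∀ p : Nat.Partition (m + 1), ((m : ℝ) + 1) * restaurantWeight θ 1 p.parts
      = ∑ j ∈ p.parts.toFinset, restaurantWeight θ 1 p.parts * (j * p.parts.count j) := fun p => by
    rw [← Finset.mul_sum, sum_toFinset_mul_count, p.parts_sum]
    push_cast; ring
  have h2 : ∀ q : Nat.Partition m, ((m : ℝ) + θ) * restaurantWeight θ 1 q.parts
      = ∑ k ∈ insert 0 q.parts.toFinset,
        restaurantWeight θ 1 q.parts * joinWeight θ k q.parts := fun q => by
    rw [← Finset.mul_sum, sum_insert_joinWeight θ q.zero_notMem, q.parts_sum]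
    ring
  rw [Finset.sum_congr rfl fun p _ => h1 p, Finset.sum_congr rfl fun q _ => h2 q,
    Finset.sum_sigma', Finset.sum_sigma']
  have hmem1 : ∀ z : (Σ _ : Nat.Partition (m + 1), ℕ),
      z ∈ (Finset.univ.sigma fun p : Nat.Partition (m + 1) => p.parts.toFinset) →
      z.2 ∈ z.1.parts := fun z hz => by simpa using hz
  have hmem2 : ∀ z : (Σ _ : Nat.Partition m, ℕ),
      z ∈ (Finset.univ.sigma fun q : Nat.Partition m => insert 0 q.parts.toFinset) →
      (z.2 = 0 ∨ z.2 ∈ z.1.parts) := fun z hz => by simpa using hz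
  refine Finset.sum_bij'
    (fun z hz => ⟨⟨removeCustomer z.2 z.1.parts, fun {i} hi => Nat.pos_of_ne_zero fun h =>
        zero_notMem_removeCustomer z.1.zero_notMem (h ▸ hi), by
        have := sum_removeCustomer z.1.zero_notMem (hmem1 z hz)
        rw [z.1.parts_sum] at this
        omega⟩, z.2 - 1⟩)
    (fun z hz => ⟨⟨addCustomer z.2 z.1.parts, fun {i} hi => Nat.pos_of_ne_zero fun h =>
        zero_notMem_addCustomer z.1.zero_notMem (h ▸ hi), by
        rw [sum_addCustomer (hmem2 z hz), z.1.parts_sum]⟩, z.2 + 1⟩) ?_ ?_ ?_ ?_ ?_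
  · intro z hz
    simpa using pred_mem_removeCustomer z.2 z.1.parts
  · intro z hz
    simpa using succ_mem_addCustomer z.2 z.1.parts
  · intro z hz
    have h := hmem1 z hz
    have hpos : 0 < z.2 := z.1.parts_pos h
    refine Sigma.ext (Nat.Partition.ext ?_) (heq_of_eq ?_)
    · exact addCustomer_removeCustomer z.1.zero_notMem h
    · simp only; omega
  · intro z hz
    refine Sigma.ext (Nat.Partition.ext ?_) (heq_of_eq ?_)
    · exact removeCustomer_addCustomer z.1.zero_notMem (hmem2 z hz)
    · simp
  · intro z hz
    have h := hmem1 z hz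
    have hpos : 0 < z.2 := z.1.parts_pos h
    have := restaurantWeight_addCustomer θ 1 (zero_notMem_removeCustomer (j := z.2)
      z.1.zero_notMem) (pred_mem_removeCustomer z.2 z.1.parts)
    rw [addCustomer_removeCustomer z.1.zero_notMem h, Nat.sub_add_cancel hpos, one_mul] at this
    exact this

theorem hCoeff_pos {θ : ℝ} (hθ : 0 < θ) (m : ℕ) : 0 < hCoeff (fun _ => θ) m := by
  induction m with
  | zero =>
    rw [hCoeff_eq]
    have : ∀ p : Nat.Partition 0, restaurantWeight θ 1 p.parts = 1 := fun p => by
      have : p.parts = 0 := by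
        rw [Multiset.eq_zero_iff_forall_notMem]
        intro j hj
        have h1 := p.parts_pos hj
        have h2 := Multiset.single_le_sum (fun _ _ => Nat.zero_le _) j hj
        rw [p.parts_sum] at h2
        omega
      rw [this, restaurantWeight_zero]
    rw [Finset.sum_congr rfl fun p _ => this p]
    simp
  | succ m ih =>
    have h := hCoeff_succ θ m
    have h1 : 0 < (m + θ) * hCoeff (fun _ => θ) m := by positivity
    rw [← h] at h1
    exact pos_of_mul_pos_right h1 (by positivity)

theorem exitRate_succ {θ : ℝ} (hθ : 0 < θ) (m : ℕ) :
    exitRate (fun _ => θ) (m + 1) = (m + 1) / (m + θ) := by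
  have h := hCoeff_succ θ m
  have h1 := hCoeff_pos hθ (m + 1)
  have h2 : (0 : ℝ) < m + θ := by positivity
  rw [exitRate, div_eq_div_iff h1.ne' h2.ne']
  linarith

theorem exitRate_nonneg {θ : ℝ} (hθ : 0 < θ) (m : ℕ) : 0 ≤ exitRate (fun _ => θ) m := by
  cases m with
  | zero => exact le_rfl
  | succ m => rw [exitRate_succ hθ]; positivity

theorem exitRate_le {θ : ℝ} (hθ : 0 < θ) (m : ℕ) : exitRate (fun _ => θ) m ≤ m / θ := by
  cases m with
  | zero => simp [exitRate]
  | succ m =>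
    rw [exitRate_succ hθ]
    push_cast
    gcongr
    linarith [m.cast_nonneg (α := ℝ)]

/-- In `g(η) j r_j / η` the factor `η` cancels and `η - 1 + θ` remains, which is the denominator of
the seating probability after the departure. -/
theorem restaurantWeight_mul_exitRate {θ : ℝ} (hθ : 0 < θ) (e : ℝ) {j : ℕ} {m : Multiset ℕ}
    (hm : 0 ∉ m) (hj : j ∈ m) :
    restaurantWeight θ e m * (exitRate (fun _ => θ) m.sum * leaveProb j m)
      = e * restaurantWeight θ e (removeCustomer j m) *
        joinProb θ (j - 1) (removeCustomer j m) := by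
  have hpos : 0 < j := Nat.pos_of_ne_zero fun h => hm (h ▸ hj)
  have h := restaurantWeight_addCustomer θ e (zero_notMem_removeCustomer (j := j) hm)
    (pred_mem_removeCustomer j m)
  rw [addCustomer_removeCustomer hm hj, Nat.sub_add_cancel hpos] at h
  rw [joinProb_eq, mul_div_assoc', ← h, ← sum_removeCustomer hm hj, exitRate_succ hθ, leaveProb,
    ← sum_removeCustomer hm hj]
  have h1 : ((removeCustomer j m).sum : ℝ) + 1 ≠ 0 := by positivity
  have h2 : ((removeCustomer j m).sum : ℝ) + θ ≠ 0 := by positivity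
  push_cast at *
  field_simp

end ExitRate

/-! ### Detailed balance for the jump rates. -/

section DetailedBalance

variable {d n : ℕ}

theorem expNeg_nonneg (v : WithTop ℝ) : 0 ≤ expNeg v := by
  cases v with
  | top => exact le_rfl
  | coe r => exact (Real.exp_pos _).le

/-- The Gibbs weight of a family of table occupations, with `e^{-V(x/L)}` replaced by `E x`. -/
def configWeight (θ : ℝ) (E : Site d → ℝ) (c : Site d →₀ Multiset ℕ) : ℝ :=
  c.prod fun x m => restaurantWeight θ (E x) m

theorem gibbsWeight_eq (θ : ℝ) (V : (Fin d → ℝ) → WithTop ℝ) (L : ℝ) (a : SpatialPartition d n) :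
    gibbsWeight (fun _ => θ) V L a
      = configWeight θ (fun x => expNeg (scaledPotential V L x)) a.parts := rfl

theorem gibbsWeight_nonneg {θ : ℝ} (hθ : 0 < θ) (V : (Fin d → ℝ) → WithTop ℝ) (L : ℝ)
    (a : SpatialPartition d n) : 0 ≤ gibbsWeight (fun _ => θ) V L a :=
  Finset.prod_nonneg fun x _ => occupationWeight_nonneg
    (fun j => mul_nonneg (by positivity) (pow_nonneg (expNeg_nonneg _) _)) _

theorem configWeight_eq_mul_erase (θ : ℝ) (E : Site d → ℝ) (c : Site d →₀ Multiset ℕ)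
    (x : Site d) :
    configWeight θ E c = restaurantWeight θ (E x) (c x) * configWeight θ E (c.erase x) :=
  (Finsupp.mul_prod_erase' c x _ fun _ => restaurantWeight_zero _ _).symm

theorem afterLeaving_self (c : Site d →₀ Multiset ℕ) (x : Site d) (j : ℕ) :
    afterLeaving c x j x = removeCustomer j (c x) := by
  simp [afterLeaving]

theorem zero_notMem_afterLeaving {c : Site d →₀ Multiset ℕ} (hc : ∀ x, 0 ∉ c x) (x : Site d)
    (j : ℕ) (y : Site d) : 0 ∉ afterLeaving c x j y := by
  by_cases h : y = x
  · subst h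
    rw [afterLeaving_self]
    exact zero_notMem_removeCustomer (hc y)
  · rw [afterLeaving, Finsupp.update_apply, if_neg h]
    exact hc y

theorem configWeight_mul_exitRate {θ : ℝ} (hθ : 0 < θ) (E : Site d → ℝ)
    {c : Site d →₀ Multiset ℕ} (hc : ∀ x, 0 ∉ c x) {x : Site d} {j : ℕ} (hj : j ∈ c x) :
    configWeight θ E c * (exitRate (fun _ => θ) (c x).sum * leaveProb j (c x))
      = E x * configWeight θ E (afterLeaving c x j) *
        joinProb θ (j - 1) (afterLeaving c x j x) := by
  rw [configWeight_eq_mul_erase θ E c x, configWeight_eq_mul_erase θ E (afterLeaving c x j) x,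
    afterLeaving_self]
  have herase : (afterLeaving c x j).erase x = c.erase x := by
    ext1 z
    by_cases h : z = x
    · subst h; simp
    · simp [h, afterLeaving]
  rw [herase]
  linear_combination configWeight θ E (c.erase x) *
    restaurantWeight_mul_exitRate hθ (E x) (hc x) hj

/-- Apart from `E x * t x y`, the right-hand side is symmetric under exchanging the seat left with
the seat taken. Since `λ*` is used in both probabilities, `y = x` needs no separate treatment. -/
theorem configWeight_mul_moveRate {θ : ℝ} (hθ : 0 < θ) (E : Site d → ℝ)
    (t : Site d → Site d → ℝ) {c : Site d →₀ Multiset ℕ} (hc : ∀ x, 0 ∉ c x) {x : Site d}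
    (y : Site d) {j : ℕ} (k : ℕ) (hj : j ∈ c x) :
    configWeight θ E c * moveRate θ t c x y j k
      = E x * t x y * configWeight θ E (afterLeaving c x j) *
        joinProb θ (j - 1) (afterLeaving c x j x) * joinProb θ k (afterLeaving c x j y) := by
  rw [moveRate]
  linear_combination t x y * joinProb θ k (afterLeaving c x j y) *
    configWeight_mul_exitRate hθ E hc hj

/-- A move and its reverse pass through the same intermediate configuration. -/
theorem afterLeaving_afterMove {c : Site d →₀ Multiset ℕ} (hc : ∀ x, 0 ∉ c x) (x y : Site d)
    {j k : ℕ} (hk : k = 0 ∨ k ∈ afterLeaving c x j y) :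
    afterLeaving (afterMove c x y j k) y (k + 1) = afterLeaving c x j := by
  ext1 z
  by_cases h : z = y
  · subst h
    rw [afterLeaving_self, afterMove, Finsupp.update_apply, if_pos rfl,
      removeCustomer_addCustomer (zero_notMem_afterLeaving hc x j z) hk]
  · rw [afterLeaving, Finsupp.update_apply, if_neg h, afterMove, Finsupp.update_apply, if_neg h]

theorem afterMove_afterMove {c : Site d →₀ Multiset ℕ} (hc : ∀ x, 0 ∉ c x) (x y : Site d)
    {j k : ℕ} (hj : j ∈ c x) (hk : k = 0 ∨ k ∈ afterLeaving c x j y) :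
    afterMove (afterMove c x y j k) y x (k + 1) (j - 1) = c := by
  rw [afterMove, afterLeaving_afterMove hc x y hk]
  ext1 z
  by_cases h : z = x
  · subst h
    rw [Finsupp.update_apply, if_pos rfl, afterLeaving_self,
      addCustomer_removeCustomer (hc z) hj]
  · rw [Finsupp.update_apply, if_neg h, afterLeaving, Finsupp.update_apply, if_neg h]

theorem mem_of_moveRate_ne_zero {θ : ℝ} {t : Site d → Site d → ℝ} {c : Site d →₀ Multiset ℕ}
    {x y : Site d} {j k : ℕ} (h : moveRate θ t c x y j k ≠ 0) :
    j ∈ c x ∧ (k = 0 ∨ k ∈ afterLeaving c x j y) := by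
  constructor
  · by_contra hj
    exact h (by simp [moveRate, leaveProb, Multiset.count_eq_zero_of_notMem hj])
  · by_contra! hk
    exact h (by simp [moveRate, joinProb, hk.1, Multiset.count_eq_zero_of_notMem hk.2])

theorem configWeight_mul_moveRate_comm {θ : ℝ} (hθ : 0 < θ) {E : Site d → ℝ}
    {t : Site d → Site d → ℝ} (hbal : ∀ x y, E x * t x y = E y * t y x)
    {c : Site d →₀ Multiset ℕ} (hc : ∀ x, 0 ∉ c x) {x y : Site d} {j k : ℕ}
    (hj : j ∈ c x) (hk : k = 0 ∨ k ∈ afterLeaving c x j y) :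
    configWeight θ E c * moveRate θ t c x y j k
      = configWeight θ E (afterMove c x y j k) *
        moveRate θ t (afterMove c x y j k) y x (k + 1) (j - 1) := by
  have hc' : ∀ z, 0 ∉ afterMove c x y j k z := fun z => by
    by_cases h : z = y
    · subst h
      rw [afterMove, Finsupp.update_apply, if_pos rfl]
      exact zero_notMem_addCustomer (zero_notMem_afterLeaving hc x j z)
    · rw [afterMove, Finsupp.update_apply, if_neg h]
      exact zero_notMem_afterLeaving hc x j z
  have hj' : k + 1 ∈ afterMove c x y j k y := by
    rw [afterMove, Finsupp.update_apply, if_pos rfl]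
    exact succ_mem_addCustomer _ _
  rw [configWeight_mul_moveRate hθ E t hc y k hj, configWeight_mul_moveRate hθ E t hc' x _ hj',
    afterLeaving_afterMove hc x y hk, Nat.add_sub_cancel, hbal x y]
  ring

theorem SpatialPartition.zero_notMem (a : SpatialPartition d n) (x : Site d) : 0 ∉ a.parts x :=
  fun h => lt_irrefl _ (a.parts_pos x 0 h)

/-- The move that undoes a given move. -/
def reverseMove (m : (Site d × Site d) × ℕ × ℕ) : (Site d × Site d) × ℕ × ℕ :=
  ((m.1.2, m.1.1), m.2.2 + 1, m.2.1 - 1)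

open Classical in
/-- The contribution of a move to the rate `q(a, b)`. -/
def moveTerm (θ : ℝ) (t : Site d → Site d → ℝ) (a b : SpatialPartition d n)
    (m : (Site d × Site d) × ℕ × ℕ) : ℝ :=
  if afterMove a.parts m.1.1 m.1.2 m.2.1 m.2.2 = b.parts then
    moveRate θ t a.parts m.1.1 m.1.2 m.2.1 m.2.2 else 0

theorem jumpRate_eq (θ : ℝ) (t : Site d → Site d → ℝ) (a b : SpatialPartition d n) :
    jumpRate θ t a b = ∑' m, moveTerm θ t a b m := rfl

/-- Positivity of the table size is recorded because `j - 1` is truncated: `reverseMove` is an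
involution only on moves with `j ≥ 1`. -/
theorem reverseMove_of_moveTerm_ne_zero {θ : ℝ} (hθ : 0 < θ) {E : Site d → ℝ}
    {t : Site d → Site d → ℝ} (hbal : ∀ x y, E x * t x y = E y * t y x)
    {a b : SpatialPartition d n} {m : (Site d × Site d) × ℕ × ℕ} (h : moveTerm θ t a b m ≠ 0) :
    0 < m.2.1 ∧ configWeight θ E a.parts * moveTerm θ t a b m
      = configWeight θ E b.parts * moveTerm θ t b a (reverseMove m) := by
  by_cases hm : afterMove a.parts m.1.1 m.1.2 m.2.1 m.2.2 = b.parts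
  · have hr : moveTerm θ t a b m = moveRate θ t a.parts m.1.1 m.1.2 m.2.1 m.2.2 := if_pos hm
    rw [hr] at h
    obtain ⟨hj, hk⟩ := mem_of_moveRate_ne_zero h
    refine ⟨a.parts_pos _ _ hj, ?_⟩
    have hback : moveTerm θ t b a (reverseMove m)
        = moveRate θ t b.parts m.1.2 m.1.1 (m.2.2 + 1) (m.2.1 - 1) := by
      refine if_pos ?_
      rw [← hm]
      exact afterMove_afterMove a.zero_notMem _ _ hj hk
    rw [hr, hback, ← hm]
    exact configWeight_mul_moveRate_comm hθ hbal a.zero_notMem hj hk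
  · exact absurd (if_neg hm) h

theorem reverseMove_reverseMove {m : (Site d × Site d) × ℕ × ℕ} (h : 0 < m.2.1) :
    reverseMove (reverseMove m) = m := by
  obtain ⟨⟨x, y⟩, j, k⟩ := m
  simp only at h
  simp [reverseMove, Nat.sub_add_cancel h]

theorem configWeight_mul_jumpRate {θ : ℝ} (hθ : 0 < θ) {E : Site d → ℝ}
    {t : Site d → Site d → ℝ} (hbal : ∀ x y, E x * t x y = E y * t y x)
    (a b : SpatialPartition d n) :
    configWeight θ E a.parts * jumpRate θ t a b = configWeight θ E b.parts * jumpRate θ t b a := by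
  rw [jumpRate_eq, jumpRate_eq, ← tsum_mul_left, ← tsum_mul_left]
  have hrev : ∀ (a b : SpatialPartition d n) {m},
      configWeight θ E a.parts * moveTerm θ t a b m ≠ 0 → 0 < m.2.1 ∧
        configWeight θ E a.parts * moveTerm θ t a b m
          = configWeight θ E b.parts * moveTerm θ t b a (reverseMove m) := fun a b m h =>
    reverseMove_of_moveTerm_ne_zero hθ hbal (right_ne_zero_of_mul h)
  -- Reversal is a bijection between the moves from `b` to `a` and those from `a` to `b` with
  -- non-zero weighted rate, so the sums agree without any summability argument.
  refine tsum_eq_tsum_of_ne_zero_bij (fun m => reverseMove m.1) ?_ ?_ ?_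
  · intro m m' h
    have := congrArg reverseMove h
    simp only [reverseMove_reverseMove (hrev b a m.2).1,
      reverseMove_reverseMove (hrev b a m'.2).1] at this
    exact Subtype.ext this
  · intro m hm
    obtain ⟨hpos, heq⟩ := hrev a b hm
    exact ⟨⟨reverseMove m, by rw [Function.mem_support, ← heq]; exact hm⟩,
      reverseMove_reverseMove hpos⟩
  · intro m
    exact (hrev b a m.2).2.symm

end DetailedBalance

/-! ### The total jump rate is at most `n / θ`. -/

section TotalRate

variable {d n : ℕ}

theorem leaveProb_nonneg (j : ℕ) (m : Multiset ℕ) : 0 ≤ leaveProb j m := by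
  unfold leaveProb; positivity

theorem joinProb_nonneg {θ : ℝ} (hθ : 0 < θ) (k : ℕ) (m : Multiset ℕ) : 0 ≤ joinProb θ k m := by
  unfold joinProb; split_ifs <;> positivity

theorem moveRate_nonneg {θ : ℝ} (hθ : 0 < θ) {t : Site d → Site d → ℝ} (ht : ∀ x y, 0 ≤ t x y)
    (c : Site d →₀ Multiset ℕ) (x y : Site d) (j k : ℕ) : 0 ≤ moveRate θ t c x y j k :=
  mul_nonneg (mul_nonneg (mul_nonneg (exitRate_nonneg hθ _) (ht x y)) (leaveProb_nonneg _ _))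
    (joinProb_nonneg hθ _ _)

/-- Only an inequality, since in an empty restaurant all the quotients are `0 / 0 = 0`. -/
theorem tsum_leaveProb_le (m : Multiset ℕ) : ∑' j, ENNReal.ofReal (leaveProb j m) ≤ 1 := by
  rw [tsum_eq_sum (s := m.toFinset) fun j hj => by
    rw [Multiset.mem_toFinset] at hj
    simp [leaveProb, Multiset.count_eq_zero_of_notMem hj],
    ← ENNReal.ofReal_sum_of_nonneg fun j _ => leaveProb_nonneg j m]
  unfold leaveProb
  rw [← Finset.sum_div, sum_toFinset_mul_count, ENNReal.ofReal_le_one]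
  exact div_self_le_one _

theorem tsum_joinProb_le {θ : ℝ} (hθ : 0 < θ) {m : Multiset ℕ} (hm : 0 ∉ m) :
    ∑' k, ENNReal.ofReal (joinProb θ k m) ≤ 1 := by
  rw [tsum_eq_sum (s := insert 0 m.toFinset) fun j hj => by
    rw [Finset.mem_insert, Multiset.mem_toFinset, not_or] at hj
    simp [joinProb, hj.1, Multiset.count_eq_zero_of_notMem hj.2],
    ← ENNReal.ofReal_sum_of_nonneg fun j _ => joinProb_nonneg hθ j m]
  simp only [joinProb_eq]
  rw [← Finset.sum_div, sum_insert_joinWeight θ hm, ENNReal.ofReal_le_one]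
  exact div_self_le_one _

theorem tsum_exitRate_le {θ : ℝ} (hθ : 0 < θ) (a : SpatialPartition d n) :
    ∑' x, ENNReal.ofReal (exitRate (fun _ => θ) (a.parts x).sum) ≤ ENNReal.ofReal (n / θ) := by
  rw [tsum_eq_sum (s := a.parts.support) fun x hx => by
    rw [Finsupp.notMem_support_iff] at hx
    simp [hx, exitRate],
    ← ENNReal.ofReal_sum_of_nonneg fun x _ => exitRate_nonneg hθ _]
  refine ENNReal.ofReal_le_ofReal ?_
  refine (Finset.sum_le_sum fun x _ => exitRate_le hθ _).trans_eq ?_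
  rw [← Finset.sum_div, ← Nat.cast_sum]
  congr 2
  exact a.sum_eq

/-- Summing over `k`, `j` and `y` in turn removes the seating, leaving and travelling probabilities,
and the exit rates remain. -/
theorem tsum_moveRate_le {θ : ℝ} (hθ : 0 < θ) {t : Site d → Site d → ℝ}
    (ht : ∀ x y, 0 ≤ t x y) (ht1 : ∀ x, HasSum (fun y => t x y) 1) (a : SpatialPartition d n) :
    ∑' m : (Site d × Site d) × ℕ × ℕ,
      ENNReal.ofReal (moveRate θ t a.parts m.1.1 m.1.2 m.2.1 m.2.2) ≤ ENNReal.ofReal (n / θ) := by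
  refine le_trans ?_ (tsum_exitRate_le hθ a)
  rw [ENNReal.tsum_prod (f := fun (p : Site d × Site d) (q : ℕ × ℕ) =>
      ENNReal.ofReal (moveRate θ t a.parts p.1 p.2 q.1 q.2)),
    ENNReal.tsum_prod (f := fun x y => ∑' q : ℕ × ℕ,
      ENNReal.ofReal (moveRate θ t a.parts x y q.1 q.2))]
  refine ENNReal.tsum_le_tsum fun x => ?_
  set g := ENNReal.ofReal (exitRate (fun _ => θ) (a.parts x).sum) with hg
  have hinner : ∀ y, ∑' z : ℕ × ℕ, ENNReal.ofReal (moveRate θ t a.parts x y z.1 z.2)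
      ≤ g * ENNReal.ofReal (t x y) := fun y => by
    rw [ENNReal.tsum_prod (f := fun j k => ENNReal.ofReal (moveRate θ t a.parts x y j k))]
    have hj : ∀ j, ∑' k, ENNReal.ofReal (moveRate θ t a.parts x y j k)
        ≤ g * ENNReal.ofReal (t x y) * ENNReal.ofReal (leaveProb j (a.parts x)) := fun j => by
      have : ∀ k, ENNReal.ofReal (moveRate θ t a.parts x y j k)
          = g * ENNReal.ofReal (t x y) * ENNReal.ofReal (leaveProb j (a.parts x)) *
            ENNReal.ofReal (joinProb θ k (afterLeaving a.parts x j y)) := fun k => by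
        have h1 := exitRate_nonneg hθ (a.parts x).sum
        rw [moveRate, ENNReal.ofReal_mul (mul_nonneg (mul_nonneg h1 (ht x y))
          (leaveProb_nonneg _ _)), ENNReal.ofReal_mul (mul_nonneg h1 (ht x y)),
          ENNReal.ofReal_mul h1]
      simp only [this]
      rw [ENNReal.tsum_mul_left]
      exact mul_le_of_le_one_right' (tsum_joinProb_le hθ
        (zero_notMem_afterLeaving a.zero_notMem x j y))
    refine (ENNReal.tsum_le_tsum hj).trans ?_
    rw [ENNReal.tsum_mul_left]
    exact mul_le_of_le_one_right' (tsum_leaveProb_le _)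
  refine (ENNReal.tsum_le_tsum hinner).trans ?_
  rw [ENNReal.tsum_mul_left, ← ENNReal.ofReal_tsum_of_nonneg (ht x) (ht1 x).summable,
    (ht1 x).tsum_eq, ENNReal.ofReal_one, mul_one]

theorem jumpRate_nonneg {θ : ℝ} (hθ : 0 < θ) {t : Site d → Site d → ℝ} (ht : ∀ x y, 0 ≤ t x y)
    (a b : SpatialPartition d n) : 0 ≤ jumpRate θ t a b :=
  tsum_nonneg fun m => by
    split_ifs
    · exact moveRate_nonneg hθ ht _ _ _ _ _
    · exact le_rfl

theorem tsum_jumpRate_le {θ : ℝ} (hθ : 0 < θ) {t : Site d → Site d → ℝ}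
    (ht : ∀ x y, 0 ≤ t x y) (ht1 : ∀ x, HasSum (fun y => t x y) 1) (a : SpatialPartition d n) :
    ∑' b, ENNReal.ofReal (jumpRate θ t a b) ≤ ENNReal.ofReal (n / θ) := by
  classical
  have hterm : ∀ b m, 0 ≤ moveTerm θ t a b m := fun b m => by
    unfold moveTerm
    split_ifs
    · exact moveRate_nonneg hθ ht _ _ _ _ _
    · exact le_rfl
  have h1 : ∀ b, ENNReal.ofReal (jumpRate θ t a b) ≤ ∑' m, ENNReal.ofReal (moveTerm θ t a b m) :=
    fun b => by
    rw [jumpRate_eq]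
    by_cases hs : Summable (moveTerm θ t a b)
    · rw [ENNReal.ofReal_tsum_of_nonneg (hterm b) hs]
    -- The real sum has default value `0` here, so the bound holds trivially.
    · rw [tsum_eq_zero_of_not_summable hs]; simp
  refine (ENNReal.tsum_le_tsum h1).trans ?_
  rw [ENNReal.tsum_comm]
  refine (ENNReal.tsum_le_tsum fun m => ?_).trans (tsum_moveRate_le hθ ht ht1 a)
  -- A move has at most one target; an impossible one may produce no spatial partition of `n` and
  -- then contributes nothing.
  by_cases hm : ∃ b : SpatialPartition d n,
      afterMove a.parts m.1.1 m.1.2 m.2.1 m.2.2 = b.parts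
  · obtain ⟨b, hb⟩ := hm
    rw [tsum_eq_single b]
    · rw [moveTerm, if_pos hb]
    · intro b' hb'
      rw [moveTerm, if_neg, ENNReal.ofReal_zero]
      exact fun h => hb' (SpatialPartition.ext (h.symm.trans hb))
  · push Not at hm
    simp [moveTerm, hm]

theorem isBoundedQMatrix_restaurantQ {θ : ℝ} (hθ : 0 < θ) {t : Site d → Site d → ℝ}
    (ht : ∀ x y, 0 ≤ t x y) (ht1 : ∀ x, HasSum (fun y => t x y) 1) :
    IsBoundedQMatrix (restaurantQ θ t : SpatialPartition d n → SpatialPartition d n → ℝ)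
      (n / θ) := by
  classical
  have hoff : ∀ a b : SpatialPartition d n,
      0 ≤ if b = a then (0 : ℝ) else jumpRate θ t a b := fun a b => by
    split_ifs
    · exact le_rfl
    · exact jumpRate_nonneg hθ ht a b
  have hle : ∀ a : SpatialPartition d n,
      ∑' b, ENNReal.ofReal (if b = a then 0 else jumpRate θ t a b) ≤ ENNReal.ofReal (n / θ) :=
    fun a => by
    refine (ENNReal.tsum_le_tsum fun b => ?_).trans (tsum_jumpRate_le hθ ht ht1 a)
    split_ifs
    · simp
    · exact le_rfl
  have hsum : ∀ a : SpatialPartition d n,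
      Summable fun b => if b = a then 0 else jumpRate θ t a b := fun a => by
    have := ENNReal.summable_toReal ((hle a).trans_lt ENNReal.ofReal_lt_top).ne
    simpa only [ENNReal.toReal_ofReal (hoff a _)] using this
  have hdiag : ∀ a : SpatialPartition d n, restaurantQ θ t a a
      = -∑' b, (if b = a then 0 else jumpRate θ t a b) := fun a => by
    rw [restaurantQ, if_pos rfl]
  refine ⟨fun a b hab => ?_, fun a => ?_, fun a => ?_⟩
  · rw [restaurantQ, if_neg hab]
    exact jumpRate_nonneg hθ ht a b
  · have h := (hsum a).hasSum.add (hasSum_ite_eq a (restaurantQ θ t a a))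
    rw [hdiag, add_neg_cancel] at h
    refine h.of_eq fun b => ?_
    by_cases hb : b = a
    · subst hb
      simp [hdiag]
    · simp [hb, restaurantQ, Ne.symm hb]
  · rw [hdiag, neg_neg]
    have h := hle a
    rw [← ENNReal.ofReal_tsum_of_nonneg (hoff a) (hsum a)] at h
    exact (ENNReal.ofReal_le_ofReal_iff (by positivity)).1 h

end TotalRate

/-! ### The chain of Chinese restaurants: countability, reversibility, stationarity. -/

instance SpatialPartition.instCountable (d n : ℕ) : Countable (SpatialPartition d n) :=
  Function.Injective.countable (f := SpatialPartition.parts) fun _ _ => SpatialPartition.ext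

instance SpatialPartition.instMeasurableSingletonClass (d n : ℕ) :
    MeasurableSingletonClass (SpatialPartition d n) := ⟨fun _ => trivial⟩

theorem gibbsWeight_mul_restaurantQ {d n : ℕ} {L θ : ℝ} (hθ : 0 < θ)
    {V : (Fin d → ℝ) → WithTop ℝ} {t : Site d → Site d → ℝ}
    (hbal : ∀ x y, expNeg (scaledPotential V L x) * t x y =
      expNeg (scaledPotential V L y) * t y x) (a b : SpatialPartition d n) :
    gibbsWeight (fun _ => θ) V L a * restaurantQ θ t a b
      = gibbsWeight (fun _ => θ) V L b * restaurantQ θ t b a := by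
  by_cases h : a = b
  · subst h; rfl
  · rw [restaurantQ, restaurantQ, if_neg h, if_neg (Ne.symm h), gibbsWeight_eq, gibbsWeight_eq]
    exact configWeight_mul_jumpRate hθ
      (E := fun x => expNeg (scaledPotential V L x)) hbal a b

theorem IsReversibleLaw.isStationaryLaw {S : Type*} {μ : PMF S} {P : ℝ≥0 → S → S → ℝ}
    (h : IsReversibleLaw μ P) (hP : IsMarkovSemigroup P) : IsStationaryLaw μ P := fun t b => by
  have := (hP.hasSum_one t b).mul_left (μ b).toReal
  rw [mul_one] at this
  exact this.of_eq fun a => h t b a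

end

theorem proposition3p3 (d n : ℕ) (L θ : ℝ) (hL : 0 < L) (hθ : 0 < θ)
    (V : (Fin d → ℝ) → WithTop ℝ)
    (hZ0 : partitionFunction n (fun _ => θ) V L ≠ 0)
    (hZ : partitionFunction n (fun _ => θ) V L ≠ ∞)
    (t : Site d → Site d → ℝ)
    (ht_nonneg : ∀ x y, 0 ≤ t x y)
    (ht_sum : ∀ x, HasSum (fun y => t x y) 1)
    (ht_balance : ∀ x y, expNeg (scaledPotential V L x) * t x y =
      expNeg (scaledPotential V L y) * t y x) :
    ∃ P : ℝ≥0 → SpatialPartition d n → SpatialPartition d n → ℝ,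
      IsMarkovSemigroup P ∧ SolvesBackward (restaurantQ θ t) P ∧
      (∀ P' : ℝ≥0 → SpatialPartition d n → SpatialPartition d n → ℝ,
        IsMarkovSemigroup P' → SolvesBackward (restaurantQ θ t) P' → P' = P) ∧
      (∀ μ : PMF (SpatialPartition d n),
        ∃ (Ω : Type) (_ : MeasurableSpace Ω) (ℙ : MeasureTheory.Measure Ω)
          (X : ℝ≥0 → Ω → SpatialPartition d n), IsMarkovProcess P μ ℙ X) ∧
      IsReversibleLaw (gibbsMeasure n (fun _ => θ) V L hZ0 hZ) P ∧
      IsStationaryLaw (gibbsMeasure n (fun _ => θ) V L hZ0 hZ) P := by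
  have hQ : IsBoundedQMatrix
      (restaurantQ θ t : SpatialPartition d n → SpatialPartition d n → ℝ) (n / θ) :=
    isBoundedQMatrix_restaurantQ hθ ht_nonneg ht_sum
  have hP := hQ.isMarkovSemigroup_transition
  have hrev : IsReversibleLaw (gibbsMeasure n (fun _ => θ) V L hZ0 hZ) hQ.transition := by
    intro s a b
    have h := hQ.reversible_transition _
      (gibbsWeight_mul_restaurantQ (L := L) (V := V) hθ ht_balance) s a b
    -- The Gibbs measure is the Gibbs weight times the constant `1 / Z`, so reversibility for the
    -- weight carries over.
    have hμ : ∀ c, (gibbsMeasure n (fun _ => θ) V L hZ0 hZ c).toReal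
        = gibbsWeight (fun _ => θ) V L c * (∑' x : SpatialPartition d n,
          ENNReal.ofReal (gibbsWeight (fun _ => θ) V L x))⁻¹.toReal := fun c => by
      refine (congrArg ENNReal.toReal (PMF.normalize_apply hZ0 hZ c)).trans ?_
      rw [ENNReal.toReal_mul, ENNReal.toReal_ofReal (gibbsWeight_nonneg hθ V L c)]
    rw [hμ, hμ]
    linear_combination
      (∑' x : SpatialPartition d n, ENNReal.ofReal (gibbsWeight (fun _ => θ) V L x))⁻¹.toReal * h
  exact ⟨hQ.transition, hP, hQ.solvesBackward_transition,
    fun P' h1 h2 => hQ.eq_of_solvesBackward h1 h2 hP hQ.solvesBackward_transition,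
    hP.exists_isMarkovProcess, hrev, hrev.isStationaryLaw hP⟩
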